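/- Let $Q\subset\mathbb{R}^2$ be a convex polygon with $M\ge 3$ vertices, interior angles $\alpha_1,\dots,\alpha_M\in(0,\pi)$ and total edge length $|\partial Q|$. For each $n\ge 3$ let $X_1,\dots,X_n$ be independent points, uniformly distributed on the boundary $\partial Q$ (with respect to arc length), let $Q_n$ be their convex hull, and let $\delta_H$ be the Hausdorff distance. For $\alpha\in(0,\pi)$ put $\ell_\alpha=1$ if $\alpha<\pi/2$ and $\ell_\alpha=1/\sin\alpha$ if $\alpha\ge\pi/2$, and for $y>\ell_\alpha$ put $$h(y,\alpha)=y\,\frac{\sin(\alpha)\sqrt{y^2-1}-\cos(\alpha)}{\sin^2(\alpha)\,y^2-1}$$ if $\alpha\ge\pi/2$, or if $\alpha<\pi/2$ and $y\le 1/\cos\alpha$; and $h(y,\alpha)=1$ if $\alpha<\pi/2$ and $y>1/\cos\alpha$. (If $\alpha<\pi/2$, the quotient can be undefined at $y=1/\sin\alpha$; the value of $h$ at this single point is irrelevant.) Then $\delta_H(Q,Q_n)$ is integrable for every $n\ge 3$, the integrals on the right-hand side below converge absolutely, and $$\lim_{n\to\infty} n\,\mathbb{E}[\delta_H(Q,Q_n)]=|\partial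 Q|\int_0^\infty\Bigl[1-\prod_{i=1}^M\Bigl(1-r\int_{\ell_{\alpha_i}}^\infty e^{-r(y+h(y,\alpha_i))}\,dy\Bigr)\Bigr]dr .$$ -/

import Mathlib

open MeasureTheory ProbabilityTheory Filter Topology Set
open scoped Real

/-- The Euclidean plane. -/
abbrev Plane : Type := EuclideanSpace ℝ (Fin 2)

namespace Polygon

/-- A polygon `v₀, v₁, …` in the plane, with its vertices listed in cyclic order, is convex (with
no vertex interior to an edge) if, for each edge, all vertices other than the two endpoints lie
strictly on the same side of the line through that edge. For at least three vertices this forces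
the vertices to be distinct, to be precisely the extreme points of their convex hull, and
consecutive ones to be joined by an edge of that convex hull. -/
def IsStrictlyConvex {M : ℕ} (p : Polygon Plane M) : Prop :=
  ∀ i j k : Fin M, j ≠ i → j ≠ finRotate M i → k ≠ i → k ≠ finRotate M i →
    (line[ℝ, p i, p (finRotate M i)]).SSameSide (p j) (p k)

/-- The closed region bounded by a convex polygon. -/
def region {M : ℕ} (p : Polygon Plane M) : Set Plane :=
  convexHull ℝ (range p.vertices)

/-- The total edge length. -/
noncomputable def perimeter {M : ℕ} (p : Polygon Plane M) : ℝ :=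
  ∑ i : Fin M, dist (p i) (p (finRotate M i))

/-- The interior angle of a convex polygon at its `i`-th vertex: the angle between the two edges
meeting there. -/
noncomputable def interiorAngle {M : ℕ} (p : Polygon Plane M) (i : Fin M) : ℝ :=
  EuclideanGeometry.angle (p ((finRotate M).symm i)) (p i) (p (finRotate M i))

end Polygon

/-- The lower limit `ℓ_α` of integration. -/
noncomputable def tangentLower (α : ℝ) : ℝ :=
  if α < π / 2 then 1 else (Real.sin α)⁻¹

/-- The function `h(y, α)`: a tangent line to the unit circle about the apex of a cone of angle `α`
that meets one ray at distance `y` from the apex meets the other one at distance `h(y, α)`; for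
acute `α` and `y > 1 / cos α` the value is `1`. -/
noncomputable def tangentLength (y α : ℝ) : ℝ :=
  if α < π / 2 ∧ (Real.cos α)⁻¹ < y then 1
  else y * ((Real.sin α * √(y ^ 2 - 1) - Real.cos α) / ((Real.sin α) ^ 2 * y ^ 2 - 1))

/-- `r ∫_{ℓ_α}^∞ exp (-r (y + h(y, α))) dy`. -/
noncomputable def vertexTail (α r : ℝ) : ℝ :=
  r * ∫ y in Ioi (tangentLower α), Real.exp (-r * (y + tangentLength y α))

/-- The Hausdorff distance between a set `Q` and the convex hull of the points `x 0, …, x (n-1)`. -/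
noncomputable def hullDistance (Q : Set Plane) {n : ℕ} (x : Fin n → Plane) : ℝ :=
  Metric.hausdorffDist Q (convexHull ℝ (range x))

/-! Let L be the perimeter and rescale lengths by n/L. For each vertex and each of its two edges,
record the distance to the nearest sample point on that edge. For small levels x_k, all 2M distances
exceed their levels exactly when the n points avoid end pieces of edges of total length Σ x_k, which
has probability (1 - Σ x_k/L)^n. After rescaling, the joint survival functions tend to those of
independent standard exponentials, so the distances converge weakly (`tendsto_scaledNearest`,
`tendsto_of_tendsto_pi_Ioi`).

The Hausdorff distance is the largest distance from a vertex to the sample hull, because distance to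
a convex set is convex (`lt_hullDistance_iff`). Once every edge is hit, which fails with probability
tending to 0, the distance at a vertex is that to the chord joining its two nearest points
(`infDist_convexHull_eq`), a continuous function of the distances, homogeneous of degree one. Hence
the tails of the rescaled Hausdorff distance converge at almost every level r. Different vertices
use disjoint pairs of coordinates, so the limit is one minus a product over vertices.

For a single corner of angle α, the chord with legs a = r y and b stays farther than r from the apex
when y > ℓ_α and b > r h(y, α), as a secant substitution shows
(`one_lt_cornerDist_iff_tangentLength`). Integrating against two exponential laws gives
`vertexTail`.

Expectations converge by the layer-cake formula and dominated convergence, with an exponential tail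
bound uniform in n (`exists_tail_bound`). -/

/-! ### Geometry of one corner: chords, tangents and the function h. -/

/-- The point of parameter `s` on the chord from `a • e₁` to `b • e₂`. -/
def chordPoint (e₁ e₂ : Plane) (a b s : ℝ) : Plane := ((1 - s) * a) • e₁ + (s * b) • e₂

/-- The distance from the origin to the chord from `a • e₁` to `b • e₂`. -/
noncomputable def cornerDist (e₁ e₂ : Plane) (a b : ℝ) : ℝ :=
  sInf ((fun s => ‖chordPoint e₁ e₂ a b s‖) '' Icc 0 1)

theorem continuous_norm_chordPoint (e₁ e₂ : Plane) :
    Continuous fun z : (ℝ × ℝ) × ℝ => ‖chordPoint e₁ e₂ z.1.1 z.1.2 z.2‖ := by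
  unfold chordPoint; fun_prop

theorem continuous_cornerDist (e₁ e₂ : Plane) :
    Continuous fun z : ℝ × ℝ => cornerDist e₁ e₂ z.1 z.2 :=
  isCompact_Icc.continuous_sInf (f := fun (z : ℝ × ℝ) s => ‖chordPoint e₁ e₂ z.1 z.2 s‖)
    (continuous_norm_chordPoint e₁ e₂)

theorem cornerDist_le (e₁ e₂ : Plane) (a b : ℝ) {s : ℝ} (hs : s ∈ Icc (0 : ℝ) 1) :
    cornerDist e₁ e₂ a b ≤ ‖chordPoint e₁ e₂ a b s‖ :=
  csInf_le ⟨0, by rintro _ ⟨_, _, rfl⟩; exact norm_nonneg _⟩ ⟨s, hs, rfl⟩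

theorem exists_cornerDist_eq (e₁ e₂ : Plane) (a b : ℝ) :
    ∃ s ∈ Icc (0 : ℝ) 1, cornerDist e₁ e₂ a b = ‖chordPoint e₁ e₂ a b s‖ :=
  isCompact_Icc.exists_sInf_image_eq ⟨0, by simp⟩
    ((continuous_norm_chordPoint e₁ e₂).comp (Continuous.prodMk_right (a, b))).continuousOn

theorem lt_cornerDist_iff {e₁ e₂ : Plane} {a b r : ℝ} :
    r < cornerDist e₁ e₂ a b ↔ ∀ s ∈ Icc (0 : ℝ) 1, r < ‖chordPoint e₁ e₂ a b s‖ := by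
  refine ⟨fun h s hs => h.trans_le (cornerDist_le e₁ e₂ a b hs), fun h => ?_⟩
  obtain ⟨s, hs, e⟩ := exists_cornerDist_eq e₁ e₂ a b
  exact e ▸ h s hs

theorem cornerDist_mul (e₁ e₂ : Plane) (a b : ℝ) {c : ℝ} (hc : 0 ≤ c) :
    cornerDist e₁ e₂ (c * a) (c * b) = c * cornerDist e₁ e₂ a b := by
  have key : ∀ s, ‖chordPoint e₁ e₂ (c * a) (c * b) s‖ = c * ‖chordPoint e₁ e₂ a b s‖ := by
    intro s
    rw [← abs_of_nonneg hc, ← Real.norm_eq_abs, ← norm_smul, Real.norm_of_nonneg hc]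
    congr 1
    simp only [chordPoint]
    module
  apply le_antisymm
  · obtain ⟨s, hs, e⟩ := exists_cornerDist_eq e₁ e₂ a b
    rw [e, ← key]
    exact cornerDist_le _ _ _ _ hs
  · obtain ⟨s, hs, e⟩ := exists_cornerDist_eq e₁ e₂ (c * a) (c * b)
    rw [e, key]
    exact mul_le_mul_of_nonneg_left (cornerDist_le _ _ _ _ hs) hc

theorem cornerDist_le_left {e₁ e₂ : Plane} (h₁ : ‖e₁‖ = 1) {a : ℝ} (b : ℝ) (ha : 0 ≤ a) :
    cornerDist e₁ e₂ a b ≤ a := by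
  simpa [chordPoint, norm_smul, h₁, abs_of_nonneg ha] using
    cornerDist_le e₁ e₂ a b (s := 0) (by simp)

theorem norm_chordPoint_sq {e₁ e₂ : Plane} (h₁ : ‖e₁‖ = 1) (h₂ : ‖e₂‖ = 1) {c : ℝ}
    (hc : inner ℝ e₁ e₂ = c) (a b s : ℝ) :
    ‖chordPoint e₁ e₂ a b s‖ ^ 2 =
      (1 - s) ^ 2 * a ^ 2 + s ^ 2 * b ^ 2 + 2 * ((1 - s) * s) * (a * b * c) := by
  rw [chordPoint, norm_add_sq_real, norm_smul, norm_smul, h₁, h₂, inner_smul_left, inner_smul_right,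
    hc]
  simp only [Real.norm_eq_abs, mul_one, sq_abs, conj_trivial]
  ring

/-- With p = √(a² - 1) and q = √(b² - 1), the squared norm of a chord point minus 1 equals ((1-s)p -
sq)² + 2s(1-s)(abc + pq - 1). The square vanishes at s = p/(p+q), which makes the last condition
necessary; away from the endpoints it is also sufficient. -/
theorem one_lt_cornerDist_iff {e₁ e₂ : Plane} (h₁ : ‖e₁‖ = 1) (h₂ : ‖e₂‖ = 1) {c a b : ℝ}
    (hc : inner ℝ e₁ e₂ = c) (ha : 0 ≤ a) (hb : 0 ≤ b) :
    1 < cornerDist e₁ e₂ a b ↔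
      1 < a ∧ 1 < b ∧ 1 < a * b * c + √(a ^ 2 - 1) * √(b ^ 2 - 1) := by
  have key : ∀ s, 1 < ‖chordPoint e₁ e₂ a b s‖ ↔
      1 < (1 - s) ^ 2 * a ^ 2 + s ^ 2 * b ^ 2 + 2 * ((1 - s) * s) * (a * b * c) := fun s => by
    rw [← norm_chordPoint_sq h₁ h₂ hc, one_lt_sq_iff₀ (norm_nonneg _)]
  rw [lt_cornerDist_iff]
  constructor
  · intro h
    have ha1 : 1 < a := by
      have := (key 0).1 (h 0 (by simp))
      norm_num at this
      exact (one_lt_sq_iff₀ ha).1 (by simpa using this)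
    have hb1 : 1 < b := by
      have := (key 1).1 (h 1 (by simp))
      norm_num at this
      exact (one_lt_sq_iff₀ hb).1 (by simpa using this)
    refine ⟨ha1, hb1, ?_⟩
    have hp2 : √(a ^ 2 - 1) ^ 2 = a ^ 2 - 1 := Real.sq_sqrt (by nlinarith)
    have hq2 : √(b ^ 2 - 1) ^ 2 = b ^ 2 - 1 := Real.sq_sqrt (by nlinarith)
    have hp : 0 < √(a ^ 2 - 1) := Real.sqrt_pos.2 (by nlinarith)
    have hq : 0 < √(b ^ 2 - 1) := Real.sqrt_pos.2 (by nlinarith)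
    set p := √(a ^ 2 - 1)
    set q := √(b ^ 2 - 1)
    have h3 := (key (p / (p + q))).1 (h _ ⟨by positivity, by rw [div_le_one (by positivity)]; linarith⟩)
    have e1 : 1 - p / (p + q) = q / (p + q) := by field_simp; ring
    rw [e1] at h3
    have h4 : 0 < (q ^ 2 * a ^ 2 + p ^ 2 * b ^ 2 + 2 * (q * p) * (a * b * c) - (p + q) ^ 2)
        / (p + q) ^ 2 := by
      have : (q ^ 2 * a ^ 2 + p ^ 2 * b ^ 2 + 2 * (q * p) * (a * b * c) - (p + q) ^ 2)
        / (p + q) ^ 2 = (q / (p + q)) ^ 2 * a ^ 2 + (p / (p + q)) ^ 2 * b ^ 2 +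
          2 * (q / (p + q) * (p / (p + q))) * (a * b * c) - 1 := by field_simp
      rw [this]; linarith
    have h5 := (div_pos_iff_of_pos_right (by positivity)).1 h4
    have ea : a ^ 2 = p ^ 2 + 1 := by linarith
    have eb : b ^ 2 = q ^ 2 + 1 := by linarith
    rw [ea, eb] at h5
    have h6 : 0 < (2 * (p * q)) * (a * b * c + p * q - 1) := by nlinarith
    have := (pos_iff_pos_of_mul_pos h6).1 (by positivity)
    linarith
  · rintro ⟨ha1, hb1, h⟩ s ⟨hs0, hs1⟩
    rw [key]
    have hp2 : √(a ^ 2 - 1) ^ 2 = a ^ 2 - 1 := Real.sq_sqrt (by nlinarith)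
    have hq2 : √(b ^ 2 - 1) ^ 2 = b ^ 2 - 1 := Real.sq_sqrt (by nlinarith)
    have hp : 0 < √(a ^ 2 - 1) := Real.sqrt_pos.2 (by nlinarith)
    have hq : 0 < √(b ^ 2 - 1) := Real.sqrt_pos.2 (by nlinarith)
    set p := √(a ^ 2 - 1)
    set q := √(b ^ 2 - 1)
    have ea : a ^ 2 = p ^ 2 + 1 := by linarith
    have eb : b ^ 2 = q ^ 2 + 1 := by linarith
    have e : (1 - s) ^ 2 * a ^ 2 + s ^ 2 * b ^ 2 + 2 * ((1 - s) * s) * (a * b * c) - 1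
        = ((1 - s) * p - s * q) ^ 2 + 2 * ((1 - s) * s) * (a * b * c + p * q - 1) := by
      rw [ea, eb]; ring
    rcases hs0.eq_or_lt with rfl | hs0
    · nlinarith
    rcases hs1.eq_or_lt with rfl | hs1
    · nlinarith
    have : 0 < 2 * ((1 - s) * s) * (a * b * c + p * q - 1) := by
      have : 0 < 1 - s := by linarith
      have : 0 < a * b * c + p * q - 1 := by linarith
      positivity
    nlinarith [sq_nonneg ((1 - s) * p - s * q)]

/-- Writing a leg as sec θ turns √(a² - 1) into tan θ and the tangency condition into one on angles:
θ is the angle at the apex between the ray and the radius to the point of tangency. -/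
theorem exists_inv_cos_eq {a : ℝ} (ha : 1 < a) :
    ∃ θ ∈ Ioo 0 (π / 2), a = (Real.cos θ)⁻¹ ∧ √(a ^ 2 - 1) = a * Real.sin θ := by
  have h0 : 0 < a⁻¹ := by positivity
  have h1 : a⁻¹ < 1 := inv_lt_one_of_one_lt₀ ha
  have hc : Real.cos (Real.arccos a⁻¹) = a⁻¹ := Real.cos_arccos (by linarith) h1.le
  refine ⟨Real.arccos a⁻¹, ⟨Real.arccos_pos.2 h1, Real.arccos_lt_pi_div_two.2 h0⟩, by simp [hc], ?_⟩
  rw [Real.sin_arccos]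
  rw [Real.sqrt_eq_iff_mul_self_eq (by nlinarith) (by positivity)]
  rw [mul_mul_mul_comm, Real.mul_self_sqrt (by nlinarith)]
  field_simp

theorem cos_pos_of_mem_Ioo_zero {θ : ℝ} (hθ : θ ∈ Ioo 0 (π / 2)) : 0 < Real.cos θ :=
  Real.cos_pos_of_mem_Ioo ⟨by linarith [hθ.1, Real.pi_pos], hθ.2⟩

/-- Clearing denominators leaves cos(θ + ψ) < cos α, and cosine decreases on [0, π]. -/
theorem one_lt_add_sqrt_iff {θ ψ α : ℝ} (hθ : θ ∈ Ioo 0 (π / 2)) (hψ : ψ ∈ Ioo 0 (π / 2))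
    (hα : α ∈ Ioo 0 π) :
    1 < (Real.cos θ)⁻¹ * (Real.cos ψ)⁻¹ * Real.cos α +
      ((Real.cos θ)⁻¹ * Real.sin θ) * ((Real.cos ψ)⁻¹ * Real.sin ψ) ↔ α - θ < ψ := by
  have h1 : 0 < Real.cos θ := cos_pos_of_mem_Ioo_zero hθ
  have h2 : 0 < Real.cos ψ := cos_pos_of_mem_Ioo_zero hψ
  have e : (Real.cos θ)⁻¹ * (Real.cos ψ)⁻¹ * Real.cos α +
      ((Real.cos θ)⁻¹ * Real.sin θ) * ((Real.cos ψ)⁻¹ * Real.sin ψ) =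
      (Real.cos α + Real.sin θ * Real.sin ψ) / (Real.cos θ * Real.cos ψ) := by field_simp
  rw [e, one_lt_div (by positivity)]
  have := Real.strictAntiOn_cos.lt_iff_gt (a := θ + ψ) (b := α)
    ⟨by linarith [hθ.1, hψ.1], by linarith [hθ.2, hψ.2]⟩ ⟨hα.1.le, hα.2.le⟩
  rw [Real.cos_add] at this
  constructor
  · intro h; have := this.1 (by linarith); linarith
  · intro h; have := this.2 (by linarith); linarith

/-- Numerator and denominator of h share the factor cos(α + θ); cancelling it leaves sec(α - θ). -/
theorem tangentLength_inv_cos {θ α : ℝ} (hθ : θ ∈ Ioo 0 (π / 2))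
    (h : ¬ (α < π / 2 ∧ (Real.cos α)⁻¹ < (Real.cos θ)⁻¹)) (hne : Real.cos (α + θ) ≠ 0) :
    tangentLength (Real.cos θ)⁻¹ α = (Real.cos (α - θ))⁻¹ := by
  have h1 : 0 < Real.cos θ := cos_pos_of_mem_Ioo_zero hθ
  have hs : 0 < Real.sin θ := Real.sin_pos_of_pos_of_lt_pi hθ.1 (by linarith [hθ.2, Real.pi_pos])
  have hsq : √((Real.cos θ)⁻¹ ^ 2 - 1) = (Real.cos θ)⁻¹ * Real.sin θ := by
    rw [Real.sqrt_eq_iff_mul_self_eq_of_pos (by positivity)]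
    field_simp
    nlinarith [Real.sin_sq_add_cos_sq θ]
  rw [tangentLength, if_neg h, hsq]
  have e1 : Real.sin α * ((Real.cos θ)⁻¹ * Real.sin θ) - Real.cos α
      = -((Real.cos θ)⁻¹ * Real.cos (α + θ)) := by
    rw [Real.cos_add]; field_simp; ring
  have e2 : Real.sin α ^ 2 * (Real.cos θ)⁻¹ ^ 2 - 1
      = -((Real.cos θ)⁻¹ ^ 2 * (Real.cos (α + θ) * Real.cos (α - θ))) := by
    rw [Real.cos_add, Real.cos_sub]; field_simp
    nlinarith [Real.sin_sq_add_cos_sq θ, Real.sin_sq_add_cos_sq α]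
  rw [e1, e2]
  -- If cos(α - θ) = 0, both sides are 0 by the convention for division by zero.
  rcases eq_or_ne (Real.cos (α - θ)) 0 with h0 | h0
  · simp [h0]
  · field_simp

theorem inv_cos_lt_iff {β b : ℝ} (hβ : β ∈ Ico 0 (π / 2)) :
    (Real.cos β)⁻¹ < b ↔ ∃ ψ ∈ Ioo 0 (π / 2), b = (Real.cos ψ)⁻¹ ∧ β < ψ := by
  have h1 : 0 < Real.cos β := Real.cos_pos_of_mem_Ioo ⟨by linarith [hβ.1, Real.pi_pos], hβ.2⟩
  constructor
  · intro h
    have hb : 1 < b := lt_of_le_of_lt ((one_le_inv₀ h1).2 (Real.cos_le_one β)) h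
    obtain ⟨ψ, hψ, rfl, -⟩ := exists_inv_cos_eq hb
    have h2 : 0 < Real.cos ψ := cos_pos_of_mem_Ioo_zero hψ
    refine ⟨ψ, hψ, rfl, ?_⟩
    rw [inv_lt_inv₀ h1 h2] at h
    exact (Real.strictAntiOn_cos.lt_iff_gt ⟨hψ.1.le, by linarith [hψ.2, Real.pi_pos]⟩
      ⟨hβ.1, by linarith [hβ.2, Real.pi_pos]⟩).1 h
  · rintro ⟨ψ, hψ, rfl, h⟩
    have h2 : 0 < Real.cos ψ := cos_pos_of_mem_Ioo_zero hψ
    rw [inv_lt_inv₀ h1 h2]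
    exact Real.strictAntiOn_cos ⟨hβ.1, by linarith [hβ.2, Real.pi_pos]⟩
      ⟨hψ.1.le, by linarith [hψ.2, Real.pi_pos]⟩ h

theorem one_lt_inv_cos {θ : ℝ} (hθ : θ ∈ Ioo 0 (π / 2)) : 1 < (Real.cos θ)⁻¹ := by
  simpa using (inv_cos_lt_iff (β := 0) (by simp [Real.pi_pos])).2 ⟨θ, hθ, rfl, hθ.1⟩

theorem one_lt_cornerDist_iff_exists {e₁ e₂ : Plane} (h₁ : ‖e₁‖ = 1) (h₂ : ‖e₂‖ = 1) {α θ b : ℝ}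
    (hα : α ∈ Ioo 0 π) (hc : inner ℝ e₁ e₂ = Real.cos α) (hθ : θ ∈ Ioo 0 (π / 2)) (hb : 0 ≤ b) :
    1 < cornerDist e₁ e₂ (Real.cos θ)⁻¹ b ↔
      ∃ ψ ∈ Ioo 0 (π / 2), b = (Real.cos ψ)⁻¹ ∧ α - θ < ψ := by
  have ha := one_lt_inv_cos hθ
  have sq : ∀ {θ}, θ ∈ Ioo 0 (π / 2) → √((Real.cos θ)⁻¹ ^ 2 - 1) = (Real.cos θ)⁻¹ * Real.sin θ := by
    intro θ hθ
    have h1 : 0 < Real.cos θ := cos_pos_of_mem_Ioo_zero hθ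
    have hs : 0 < Real.sin θ := Real.sin_pos_of_pos_of_lt_pi hθ.1 (by linarith [hθ.2, Real.pi_pos])
    rw [Real.sqrt_eq_iff_mul_self_eq_of_pos (by positivity)]
    field_simp
    nlinarith [Real.sin_sq_add_cos_sq θ]
  rw [one_lt_cornerDist_iff h₁ h₂ hc (by linarith) hb, sq hθ]
  constructor
  · rintro ⟨-, hb1, h⟩
    obtain ⟨ψ, hψ, rfl, -⟩ := exists_inv_cos_eq hb1
    rw [sq hψ, one_lt_add_sqrt_iff hθ hψ hα] at h
    exact ⟨ψ, hψ, rfl, h⟩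
  · rintro ⟨ψ, hψ, rfl, h⟩
    rw [sq hψ, one_lt_add_sqrt_iff hθ hψ hα]
    exact ⟨ha, one_lt_inv_cos hψ, h⟩

theorem one_le_tangentLower {α : ℝ} (hα : α ∈ Ioo 0 π) : 1 ≤ tangentLower α := by
  unfold tangentLower
  split_ifs
  · rfl
  · exact (one_le_inv₀ (Real.sin_pos_of_mem_Ioo hα)).2 (Real.sin_le_one α)

theorem tangentLower_lt_inv_cos_iff {α θ : ℝ} (hα : α ∈ Ioo 0 π) (hθ : θ ∈ Ioo 0 (π / 2)) :
    tangentLower α < (Real.cos θ)⁻¹ ↔ α - θ < π / 2 := by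
  unfold tangentLower
  split_ifs with h
  · exact iff_of_true (one_lt_inv_cos hθ) (by linarith [hθ.1])
  · push Not at h
    have h1 : 0 < Real.cos θ := cos_pos_of_mem_Ioo_zero hθ
    rw [inv_lt_inv₀ (Real.sin_pos_of_mem_Ioo hα) h1, ← Real.cos_sub_pi_div_two α,
      Real.strictAntiOn_cos.lt_iff_gt ⟨hθ.1.le, by linarith [hθ.2, Real.pi_pos]⟩
        ⟨by linarith, by linarith [hα.2, Real.pi_pos]⟩]
    constructor <;> intro <;> linarith

/-- Since α + θ lies in (0, 3π/2), the cosine can vanish only at π/2, that is, at y = 1/sin α, the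
point where the quotient is undefined for acute α. -/
theorem cos_add_ne_zero {α θ : ℝ} (hα : α ∈ Ioo 0 π) (hθ : θ ∈ Ioo 0 (π / 2))
    (hne : (Real.cos θ)⁻¹ ≠ (Real.sin α)⁻¹) : Real.cos (α + θ) ≠ 0 := by
  intro h0
  have h1 : α + θ = π / 2 :=
    Real.injOn_cos ⟨by linarith [hα.1, hθ.1], ?_⟩ ⟨by linarith [Real.pi_pos], by linarith [Real.pi_pos]⟩
      (by simp [h0])
  · apply hne
    rw [show α = π / 2 - θ by linarith, Real.sin_pi_div_two_sub]
  · by_contra! h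
    refine (Real.cos_neg_of_pi_div_two_lt_of_lt (x := α + θ) (by linarith [Real.pi_pos]) ?_).ne h0
    linarith [hα.2, hθ.2]

/-- In secant variables the condition is ψ > α - θ. If θ > α it holds for every ψ > 0, giving h = 1;
if 0 ≤ α - θ < π/2 it reads b > sec(α - θ); if α - θ ≥ π/2 it is impossible, and this is the range
excluded by ℓ_α. -/
theorem one_lt_cornerDist_iff_tangentLength {e₁ e₂ : Plane} (h₁ : ‖e₁‖ = 1) (h₂ : ‖e₂‖ = 1)
    {α a b : ℝ} (hα : α ∈ Ioo 0 π) (hc : inner ℝ e₁ e₂ = Real.cos α) (ha : 0 ≤ a) (hb : 0 ≤ b)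
    (hne : a ≠ (Real.sin α)⁻¹) :
    1 < cornerDist e₁ e₂ a b ↔ tangentLower α < a ∧ tangentLength a α < b := by
  rcases le_or_gt a 1 with ha1 | ha1
  · refine iff_of_false (fun h => ?_) (fun h => ?_)
    · exact absurd ((one_lt_cornerDist_iff h₁ h₂ hc ha hb).1 h).1 ha1.not_gt
    · linarith [h.1, one_le_tangentLower hα]
  obtain ⟨θ, hθ, rfl, -⟩ := exists_inv_cos_eq ha1
  rw [one_lt_cornerDist_iff_exists h₁ h₂ hα hc hθ hb, tangentLower_lt_inv_cos_iff hα hθ]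
  by_cases hcase : α < π / 2 ∧ (Real.cos α)⁻¹ < (Real.cos θ)⁻¹
  · have hαθ : α < θ := by
      obtain ⟨ψ, hψ, he, hlt⟩ := (inv_cos_lt_iff ⟨hα.1.le, hcase.1⟩).1 hcase.2
      rwa [Real.injOn_cos ⟨hθ.1.le, by linarith [hθ.2, Real.pi_pos]⟩
        ⟨hψ.1.le, by linarith [hψ.2, Real.pi_pos]⟩ (inv_injective he)]
    have h1 := inv_cos_lt_iff (β := 0) (b := b) (by simp [Real.pi_pos])
    rw [Real.cos_zero, inv_one] at h1
    rw [tangentLength, if_pos hcase, h1]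
    constructor
    · rintro ⟨ψ, hψ, he, -⟩
      exact ⟨by linarith [hα.1, hθ.1, Real.pi_pos], ψ, hψ, he, hψ.1⟩
    · rintro ⟨-, ψ, hψ, he, -⟩
      exact ⟨ψ, hψ, he, by linarith [hψ.1]⟩
  · rw [tangentLength_inv_cos hθ hcase (cos_add_ne_zero hα hθ hne)]
    have hβ0 : 0 ≤ α - θ := by
      by_contra! hlt
      apply hcase
      have : α < π / 2 := by linarith [hθ.2]
      exact ⟨this, (inv_cos_lt_iff ⟨hα.1.le, this⟩).2 ⟨θ, hθ, rfl, by linarith⟩⟩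
    constructor
    · rintro ⟨ψ, hψ, rfl, hlt⟩
      have : α - θ < π / 2 := by linarith [hψ.2]
      exact ⟨this, (inv_cos_lt_iff ⟨hβ0, this⟩).2 ⟨ψ, hψ, rfl, hlt⟩⟩
    · rintro ⟨hlt, h⟩
      exact (inv_cos_lt_iff ⟨hβ0, hlt⟩).1 h

/-- The undefined point needs no exclusion here: division by zero gives the value 0. -/
theorem tangentLength_nonneg {α y : ℝ} (hα : α ∈ Ioo 0 π) (hy : tangentLower α < y) :
    0 ≤ tangentLength y α := by
  by_cases hne : y = (Real.sin α)⁻¹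
  · unfold tangentLength
    split_ifs
    · exact zero_le_one
    · have : (Real.sin α) ^ 2 * y ^ 2 - 1 = 0 := by
        rw [hne, ← mul_pow, mul_inv_cancel₀ (Real.sin_pos_of_mem_Ioo hα).ne']; norm_num
      simp [this]
  · obtain ⟨θ, hθ, rfl, -⟩ := exists_inv_cos_eq ((one_le_tangentLower hα).trans_lt hy)
    by_cases hcase : α < π / 2 ∧ (Real.cos α)⁻¹ < (Real.cos θ)⁻¹
    · rw [tangentLength, if_pos hcase]; exact zero_le_one
    · rw [tangentLength_inv_cos hθ hcase (cos_add_ne_zero hα hθ hne)]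
      rw [tangentLower_lt_inv_cos_iff hα hθ] at hy
      exact inv_nonneg.2 (Real.cos_nonneg_of_mem_Icc ⟨by linarith [hα.1, hθ.2], hy.le⟩)

theorem measurable_tangentLength (α : ℝ) : Measurable fun y => tangentLength y α := by
  unfold tangentLength
  refine Measurable.ite ?_ measurable_const (by fun_prop)
  exact (MeasurableSet.const _).inter measurableSet_Ioi

theorem integrableOn_exp_tangentLength {α r : ℝ} (hα : α ∈ Ioo 0 π) (hr : 0 < r) :
    IntegrableOn (fun y => Real.exp (-r * (y + tangentLength y α))) (Ioi (tangentLower α)) := by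
  refine Integrable.mono' (integrableOn_exp_mul_Ioi (a := -r) (by linarith) (tangentLower α)) ?_ ?_
  · have := measurable_tangentLength α
    exact Measurable.aestronglyMeasurable (by fun_prop)
  · refine (ae_restrict_iff' measurableSet_Ioi).2 (Eventually.of_forall fun y hy => ?_)
    rw [Real.norm_of_nonneg (Real.exp_pos _).le]
    exact Real.exp_le_exp.2 (by nlinarith [mul_nonneg hr.le (tangentLength_nonneg hα hy)])

/-! ### The corner distance for independent exponential legs. -/

theorem expMeasure_one_Ioi (x : ℝ) : expMeasure 1 (Ioi x) = ENNReal.ofReal (Real.exp (-max x 0)) := by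
  have := isProbabilityMeasure_expMeasure one_pos
  have h := cdf_expMeasure_eq one_pos x
  rw [cdf_eq_real] at h
  have h2 : (expMeasure 1).real (Ioi x) = 1 - (expMeasure 1).real (Iic x) := by
    rw [← compl_Iic, probReal_compl_eq_one_sub measurableSet_Iic]
  rw [← ofReal_measureReal, h2, h]
  split_ifs with h0
  · simp [max_eq_left h0]
  · simp [max_eq_right (le_of_not_ge h0)]

theorem lintegral_expMeasure_one (f : ℝ → ENNReal) :
    ∫⁻ x, f x ∂(expMeasure 1) = ∫⁻ x in Ioi 0, ENNReal.ofReal (Real.exp (-x)) * f x := by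
  have e : expMeasure 1 = volume.withDensity (exponentialPDF 1) := rfl
  have hm : Measurable (exponentialPDF 1) := (measurable_exponentialPDFReal 1).ennreal_ofReal
  rw [e, lintegral_withDensity_eq_lintegral_mul_non_measurable _ hm
    (Eventually.of_forall fun _ => ENNReal.ofReal_lt_top), restrict_Ioi_eq_restrict_Ici,
    ← lintegral_indicator measurableSet_Ici]
  congr with x
  by_cases hx : 0 ≤ x
  · simp [indicator, hx, exponentialPDF_of_nonneg hx]
  · simp [indicator, hx, exponentialPDF_of_neg (not_le.1 hx)]

theorem expMeasure_one_Iio_zero : expMeasure 1 (Iio 0) = 0 := by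
  have e : expMeasure 1 = volume.withDensity (exponentialPDF 1) := rfl
  rw [e, withDensity_apply _ measurableSet_Iio, lintegral_exponentialPDF_of_nonpos le_rfl]

theorem expMeasure_lt_cornerDist {e₁ e₂ : Plane} (h₁ : ‖e₁‖ = 1) (h₂ : ‖e₂‖ = 1)
    {α r a : ℝ} (hα : α ∈ Ioo 0 π) (hc : inner ℝ e₁ e₂ = Real.cos α) (hr : 0 < r) (ha : 0 ≤ a)
    (hne : a ≠ r * (Real.sin α)⁻¹) :
    expMeasure 1 {b | r < cornerDist e₁ e₂ a b} =
      (Ioi (r * tangentLower α)).indicator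
        (fun a => ENNReal.ofReal (Real.exp (-(r * tangentLength (a / r) α)))) a := by
  have key : ∀ b, 0 ≤ b → (r < cornerDist e₁ e₂ a b ↔
      r * tangentLower α < a ∧ r * tangentLength (a / r) α < b) := fun b hb => by
    have e : cornerDist e₁ e₂ a b = r * cornerDist e₁ e₂ (a / r) (b / r) := by
      rw [← cornerDist_mul _ _ _ _ hr.le, mul_div_cancel₀ _ hr.ne', mul_div_cancel₀ _ hr.ne']
    rw [e, lt_mul_iff_one_lt_right hr, one_lt_cornerDist_iff_tangentLength h₁ h₂ hα hc
      (by positivity) (by positivity), lt_div_iff₀' hr, lt_div_iff₀' hr]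
    rintro h
    exact hne (by rw [← h, mul_div_cancel₀ _ hr.ne'])
  have hnn : ∀ᵐ b ∂(expMeasure 1), 0 ≤ b := by
    filter_upwards [measure_eq_zero_iff_ae_notMem.1 expMeasure_one_Iio_zero] with b hb
    exact not_lt.1 hb
  by_cases h : r * tangentLower α < a
  · have h0 : 0 ≤ tangentLength (a / r) α := tangentLength_nonneg hα (by rwa [lt_div_iff₀' hr])
    rw [indicator_of_mem (show a ∈ Ioi _ from h), ← max_eq_left (mul_nonneg hr.le h0),
      ← expMeasure_one_Ioi]
    refine measure_congr ?_
    filter_upwards [hnn] with b hb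
    exact propext ((key b hb).trans (and_iff_right h))
  · rw [indicator_of_notMem (show a ∉ Ioi _ from h)]
    refine measure_eq_zero_iff_ae_notMem.2 ?_
    filter_upwards [hnn] with b hb hb'
    exact h ((key b hb).1 hb').1

/-- Conditioning on the first leg a, the second must exceed r h(a/r, α), with probability exp(-r h).
The substitution a = r y then produces the integral and its prefactor r; the exceptional value of a
is a null set. -/
theorem expMeasure_prod_lt_cornerDist {e₁ e₂ : Plane} (h₁ : ‖e₁‖ = 1) (h₂ : ‖e₂‖ = 1)
    {α r : ℝ} (hα : α ∈ Ioo 0 π) (hc : inner ℝ e₁ e₂ = Real.cos α) (hr : 0 < r) :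
    ((expMeasure 1).prod (expMeasure 1)) {z | r < cornerDist e₁ e₂ z.1 z.2} =
      ENNReal.ofReal (vertexTail α r) := by
  have := isProbabilityMeasure_expMeasure one_pos
  have hm : MeasurableSet {z : ℝ × ℝ | r < cornerDist e₁ e₂ z.1 z.2} :=
    (isOpen_lt continuous_const (continuous_cornerDist e₁ e₂)).measurableSet
  have hℓ := mul_pos hr (one_pos.trans_le (one_le_tangentLower hα))
  set F : ℝ → ℝ := fun y => Real.exp (-r * (y + tangentLength y α))
  have hF := integrableOn_exp_tangentLength hα hr
  have hcomp : (fun y => F (r * y / r)) = F := by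
    ext y; rw [mul_div_cancel_left₀ _ hr.ne']
  have hFr : IntegrableOn (fun a => F (a / r)) (Ioi (r * tangentLower α)) := by
    rw [← integrableOn_Ioi_comp_mul_left_iff _ _ hr, hcomp]
    exact hF
  rw [Measure.prod_apply hm, lintegral_expMeasure_one]
  have h1 : ∫⁻ a in Ioi 0, ENNReal.ofReal (Real.exp (-a)) *
      expMeasure 1 (Prod.mk a ⁻¹' {z : ℝ × ℝ | r < cornerDist e₁ e₂ z.1 z.2}) =
      ∫⁻ a in Ioi 0, (Ioi (r * tangentLower α)).indicator
        (fun a => ENNReal.ofReal (F (a / r))) a := by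
    refine lintegral_congr_ae ?_
    filter_upwards [ae_restrict_mem measurableSet_Ioi,
      ae_restrict_of_ae (compl_mem_ae_iff.2 (measure_singleton (r * (Real.sin α)⁻¹)))] with a ha hne
    rw [preimage_ofPred_eq, expMeasure_lt_cornerDist h₁ h₂ hα hc hr (le_of_lt ha) hne]
    by_cases h : a ∈ Ioi (r * tangentLower α)
    · rw [indicator_of_mem h, indicator_of_mem h, ← ENNReal.ofReal_mul (Real.exp_pos _).le,
        ← Real.exp_add]
      congr 2
      field_simp
      ring
    · rw [indicator_of_notMem h, indicator_of_notMem h, mul_zero]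
  rw [h1, lintegral_indicator measurableSet_Ioi, Measure.restrict_restrict measurableSet_Ioi,
    Ioi_inter_Ioi, max_eq_left hℓ.le, ← ofReal_integral_eq_lintegral_ofReal hFr
      (Eventually.of_forall fun _ => (Real.exp_pos _).le)]
  congr 1
  have h2 := integral_comp_mul_left_Ioi (fun a => F (a / r)) (tangentLower α) hr
  rw [hcomp, smul_eq_mul, eq_inv_mul_iff_mul_eq₀ hr.ne'] at h2
  rw [← h2, vertexTail]

/-! ### Weak convergence from joint survival functions. -/

theorem isPiSystem_pi_Ioc {κ : Type*} : IsPiSystem {s : Set (κ → ℝ) | ∃ x y : κ → ℝ,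
    (∀ k, x k ≤ y k) ∧ s = univ.pi fun k => Ioc (x k) (y k)} := by
  rintro _ ⟨x, y, hxy, rfl⟩ _ ⟨x', y', hxy', rfl⟩ ⟨z, hz, hz'⟩
  refine ⟨fun k => max (x k) (x' k), fun k => min (y k) (y' k), fun k => ?_, ?_⟩
  · have := hz k trivial
    have := hz' k trivial
    simp only [mem_Ioc] at *
    simp only [max_le_iff, le_min_iff]
    grind
  · rw [← pi_inter_distrib]
    simp only [Ioc_inter_Ioc]

section Boxes

variable {κ : Type*} [Fintype κ]

/-- Inclusion-exclusion: each factor is 1_{>x} - 1_{>y}, and the product is expanded over the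
subsets where the first term is chosen. -/
theorem indicator_pi_Ioc_eq (x y : κ → ℝ) [DecidableEq κ] (hxy : ∀ k, x k ≤ y k) (z : κ → ℝ) :
    (univ.pi fun k => Ioc (x k) (y k)).indicator (1 : (κ → ℝ) → ℝ) z =
      ∑ t : Finset κ, (∏ _k ∈ Finset.univ \ t, (-1 : ℝ)) *
        (univ.pi fun k => Ioi (if k ∈ t then x k else y k)).indicator 1 z := by
  have h1 : ∀ s : κ → Set ℝ, (univ.pi s).indicator (1 : (κ → ℝ) → ℝ) z =
      ∏ k, (s k).indicator (1 : ℝ → ℝ) (z k) := fun s => by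
    by_cases h : z ∈ univ.pi s
    · rw [indicator_of_mem h, Finset.prod_eq_one]
      · rfl
      · intro k _; rw [indicator_of_mem (h k trivial)]; rfl
    · rw [indicator_of_notMem h]
      simp only [mem_univ_pi, not_forall] at h
      obtain ⟨k, hk⟩ := h
      rw [Finset.prod_eq_zero (Finset.mem_univ k) (indicator_of_notMem hk _)]
  have h2 : ∀ k, (Ioc (x k) (y k)).indicator (1 : ℝ → ℝ) (z k) =
      (Ioi (x k)).indicator 1 (z k) + -1 * (Ioi (y k)).indicator 1 (z k) := fun k => by
    have := hxy k
    simp only [indicator, mem_Ioc, mem_Ioi, Pi.one_apply]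
    split_ifs <;> grind
  rw [h1, Finset.prod_congr rfl fun k _ => h2 k, Finset.prod_add, Finset.powerset_univ]
  refine Finset.sum_congr rfl fun t _ => ?_
  rw [h1, Finset.prod_mul_distrib, mul_left_comm]
  congr 1
  rw [← Finset.prod_sdiff (Finset.subset_univ t), mul_comm]
  congr 1 <;> refine Finset.prod_congr rfl fun k hk => ?_
  · rw [if_neg (Finset.mem_sdiff.1 hk).2]
  · rw [if_pos hk]

theorem measureReal_pi_Ioc_eq (μ : Measure (κ → ℝ)) [IsProbabilityMeasure μ] [DecidableEq κ]
    (x y : κ → ℝ) (hxy : ∀ k, x k ≤ y k) :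
    μ.real (univ.pi fun k => Ioc (x k) (y k)) =
      ∑ t : Finset κ, (∏ _k ∈ Finset.univ \ t, (-1 : ℝ)) *
        μ.real (univ.pi fun k => Ioi (if k ∈ t then x k else y k)) := by
  have hm : ∀ x : κ → ℝ, MeasurableSet (univ.pi fun k => Ioi (x k)) := fun x =>
    MeasurableSet.univ_pi fun k => measurableSet_Ioi
  have hm' : MeasurableSet (univ.pi fun k => Ioc (x k) (y k)) :=
    MeasurableSet.univ_pi fun k => measurableSet_Ioc
  rw [← integral_indicator_one hm', integral_congr_ae
    (Eventually.of_forall (indicator_pi_Ioc_eq x y hxy)), integral_finsetSum]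
  · refine Finset.sum_congr rfl fun t _ => ?_
    rw [integral_const_mul, integral_indicator_one (hm _)]
  · intro t _
    exact ((integrable_const (1 : ℝ)).indicator (hm _)).const_mul _

/-- Convergence of joint survival functions implies weak convergence. -/
theorem tendsto_of_tendsto_pi_Ioi {ν : ProbabilityMeasure (κ → ℝ)}
    {μ : ℕ → ProbabilityMeasure (κ → ℝ)}
    (h : ∀ x : κ → ℝ, Tendsto (fun n => (μ n : Measure (κ → ℝ)).real (univ.pi fun k => Ioi (x k)))
      atTop (𝓝 ((ν : Measure (κ → ℝ)).real (univ.pi fun k => Ioi (x k))))) :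
    Tendsto μ atTop (𝓝 ν) := by
  classical
  refine isPiSystem_pi_Ioc.tendsto_probabilityMeasure_of_tendsto_of_mem ?_ ?_ ?_
  · rintro _ ⟨x, y, -, rfl⟩
    exact MeasurableSet.univ_pi fun k => measurableSet_Ioc
  · intro u hu z hz
    obtain ⟨ε, hε, hsub⟩ := Metric.isOpen_iff.1 hu z hz
    refine ⟨_, ⟨fun k => z k - ε / 2, fun k => z k + ε / 2, fun k => by linarith, rfl⟩, ?_, ?_⟩
    · exact set_pi_mem_nhds finite_univ fun k _ => Ioc_mem_nhds (by linarith) (by linarith)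
    · intro w hw
      refine hsub (Metric.mem_ball.2 (lt_of_le_of_lt ?_ (half_lt_self hε)))
      refine (dist_pi_le_iff (by linarith)).2 fun k => ?_
      have := hw k trivial
      rw [Real.dist_eq, abs_le]
      constructor <;> linarith [this.1, this.2]
  · rintro _ ⟨x, y, hxy, rfl⟩
    rw [← NNReal.tendsto_coe]
    change Tendsto (fun n => (μ n : Measure (κ → ℝ)).real (univ.pi fun k => Ioc (x k) (y k))) atTop
      (𝓝 ((ν : Measure (κ → ℝ)).real (univ.pi fun k => Ioc (x k) (y k))))
    simp only [measureReal_pi_Ioc_eq _ x y hxy]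
    exact tendsto_finsetSum _ fun t _ => (h _).const_mul _

instance : IsProbabilityMeasure (expMeasure 1) := isProbabilityMeasure_expMeasure one_pos

theorem pi_expMeasure_one_pi_Ioi (x : κ → ℝ) :
    (Measure.pi fun _ : κ => expMeasure 1).real (univ.pi fun k => Ioi (x k)) =
      Real.exp (-∑ k, max (x k) 0) := by
  rw [Measure.real, Measure.pi_pi]
  simp only [expMeasure_one_Ioi]
  rw [← ENNReal.ofReal_prod_of_nonneg fun _ _ => (Real.exp_pos _).le, ← Real.exp_sum,
    Finset.sum_neg_distrib, ENNReal.toReal_ofReal (Real.exp_pos _).le]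

/-- At almost every level, the distribution functions of a continuous statistic converge. -/
theorem ae_tendsto_measureReal_lt {ν : ProbabilityMeasure (κ → ℝ)}
    {μ : ℕ → ProbabilityMeasure (κ → ℝ)} (h : Tendsto μ atTop (𝓝 ν)) {g : (κ → ℝ) → ℝ}
    (hg : Continuous g) :
    ∀ᵐ r : ℝ, Tendsto (fun n => (μ n : Measure (κ → ℝ)).real {z | r < g z}) atTop
      (𝓝 ((ν : Measure (κ → ℝ)).real {z | r < g z})) := by
  -- Level sets are disjoint, so only countably many carry positive mass; every other level gives an
  -- event with null frontier.
  have hc := Measure.countable_meas_level_set_pos (μ := (ν : Measure (κ → ℝ))) hg.measurable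
  filter_upwards [compl_mem_ae_iff.2 (hc.measure_zero volume)] with r hr
  have hr0 : (ν : Measure (κ → ℝ)) {z | g z = r} = 0 := by
    by_contra hne
    exact hr (pos_iff_ne_zero.2 hne)
  have hf : (ν : Measure (κ → ℝ)) (frontier {z | r < g z}) = 0 := by
    refine measure_mono_null ?_ hr0
    exact (frontier_lt_subset_eq continuous_const hg).trans fun z hz => Eq.symm hz
  have := ProbabilityMeasure.tendsto_measure_of_null_frontier_of_tendsto' h hf
  exact (ENNReal.tendsto_toReal (measure_ne_top _ _)).comp this

end Boxes

/-! ### Independence of the corners. -/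

theorem measurePreserving_sum_prod {ι : Type*} [Fintype ι] (m : Measure ℝ) [SigmaFinite m] :
    MeasurePreserving (fun (z : ι ⊕ ι → ℝ) (i : ι) => (z (Sum.inl i), z (Sum.inr i)))
      (Measure.pi fun _ : ι ⊕ ι => m) (Measure.pi fun _ : ι => m.prod m) :=
  (measurePreserving_arrowProdEquivProdArrow ℝ ℝ ι (fun _ => m) fun _ => m).symm.comp
    (measurePreserving_sumPiEquivProdPi (X := fun _ : ι ⊕ ι => ℝ) fun _ => m)

/-- The 2M coordinates regroup into M independent pairs, so the complementary event is a product of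
events. -/
theorem measureReal_exists_lt_eq {ι : Type*} [Fintype ι] (m : Measure ℝ) [IsProbabilityMeasure m]
    (D : ι → ℝ × ℝ → ℝ) (hD : ∀ i, Measurable (D i)) (r : ℝ) :
    (Measure.pi fun _ : ι ⊕ ι => m).real
        {z | ∃ i, r < D i (z (Sum.inl i), z (Sum.inr i))} =
      1 - ∏ i, (1 - (m.prod m).real {z | r < D i z}) := by
  have hm : ∀ i, MeasurableSet {z : ℝ × ℝ | r < D i z} := fun i =>
    measurableSet_lt measurable_const (hD i)
  have e : {z : ι ⊕ ι → ℝ | ∃ i, r < D i (z (Sum.inl i), z (Sum.inr i))} =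
      ((fun (z : ι ⊕ ι → ℝ) (i : ι) => (z (Sum.inl i), z (Sum.inr i))) ⁻¹'
        (univ.pi fun i => {z | r < D i z}ᶜ))ᶜ := by
    ext z; simp
  have hpi : MeasurableSet (univ.pi fun i => {z : ℝ × ℝ | r < D i z}ᶜ) :=
    MeasurableSet.univ_pi fun i => (hm i).compl
  have hp := measurePreserving_sum_prod (ι := ι) m
  rw [e, probReal_compl_eq_one_sub (hp.measurable hpi), hp.measureReal_preimage
    hpi.nullMeasurableSet, Measure.real, Measure.pi_pi, ENNReal.toReal_prod]
  congr 1
  refine Finset.prod_congr rfl fun i _ => ?_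
  exact probReal_compl_eq_one_sub (hm i)

/-! ### Convex polygons through supporting functionals, and their boundary. -/

/-- Linear functionals `G i` supporting a cyclically ordered configuration of points along the
edges from `p i` to `p (τ i)`, and along these edges only. -/
structure ConvexCycle {ι : Type*} (τ : Equiv.Perm ι) (p : ι → Plane) (G : ι → Plane →ₗ[ℝ] ℝ) :
    Prop where
  ne : ∀ i, τ i ≠ i
  ne_symm : ∀ i, τ i ≠ τ.symm i
  eq : ∀ i, G i (p (τ i)) = G i (p i)
  lt : ∀ i j, j ≠ i → j ≠ τ i → G i (p i) < G i (p j)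

theorem exists_weights_of_mem_convexHull_range {ι E : Type*} [Fintype ι] [AddCommGroup E]
    [Module ℝ E] {p : ι → E} {x : E} (hx : x ∈ convexHull ℝ (range p)) :
    ∃ w ∈ stdSimplex ℝ ι, ∑ i, w i • p i = x := by
  classical
  have hc : Convex ℝ ((Fintype.linearCombination ℝ p) '' stdSimplex ℝ ι) :=
    (convex_stdSimplex ℝ ι).linear_image _
  refine (convexHull_min ?_ hc) hx
  rintro _ ⟨i, rfl⟩
  exact ⟨Pi.single i 1, single_mem_stdSimplex ℝ i, by simp⟩

namespace ConvexCycle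

variable {ι : Type*} {τ : Equiv.Perm ι} {p : ι → Plane} {G : ι → Plane →ₗ[ℝ] ℝ}

theorem symm_ne (H : ConvexCycle τ p G) (i : ι) : τ.symm i ≠ i := fun h =>
  H.ne i (by conv_lhs => rw [← h, τ.apply_symm_apply])

theorem eq_symm (H : ConvexCycle τ p G) (i : ι) : G (τ.symm i) (p (τ.symm i)) = G (τ.symm i) (p i) := by
  simpa using (H.eq (τ.symm i)).symm

theorem le (H : ConvexCycle τ p G) (i j : ι) : G i (p i) ≤ G i (p j) := by
  by_cases h1 : j = i
  · rw [h1]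
  by_cases h2 : j = τ i
  · rw [h2, H.eq]
  exact (H.lt i j h1 h2).le

theorem symm_le (H : ConvexCycle τ p G) (i j : ι) : G (τ.symm i) (p i) ≤ G (τ.symm i) (p j) :=
  H.eq_symm i ▸ H.le _ _

theorem symm_lt (H : ConvexCycle τ p G) {i j : ι} (h1 : j ≠ i) (h2 : j ≠ τ.symm i) :
    G (τ.symm i) (p i) < G (τ.symm i) (p j) :=
  H.eq_symm i ▸ H.lt _ _ h2 (by simpa using h1)

theorem lt_symm (H : ConvexCycle τ p G) (i : ι) : G i (p i) < G i (p (τ.symm i)) :=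
  H.lt _ _ (H.symm_ne i) (H.ne_symm i).symm

theorem symm_lt_next (H : ConvexCycle τ p G) (i : ι) :
    G (τ.symm i) (p i) < G (τ.symm i) (p (τ i)) :=
  H.symm_lt (H.ne i) (H.ne_symm i)

/-- The sum of the two functionals at a vertex exposes it. -/
theorem add_lt_add (H : ConvexCycle τ p G) {i j : ι} (h : j ≠ i) :
    G i (p i) + G (τ.symm i) (p i) < G i (p j) + G (τ.symm i) (p j) := by
  by_cases h1 : j = τ i
  · subst h1; rw [H.eq]; linarith [H.symm_lt_next i]
  · linarith [H.lt i j h h1, H.symm_le i j]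

theorem injective (H : ConvexCycle τ p G) : Function.Injective p := fun i j h => by
  by_contra hne
  have := H.add_lt_add (Ne.symm hne : j ≠ i)
  rw [h] at this
  exact this.false

/-- Each of the two functionals at the vertex kills one edge vector and is positive on the other. -/
theorem linearIndependent (H : ConvexCycle τ p G) (i : ι) :
    LinearIndependent ℝ ![p (τ i) - p i, p (τ.symm i) - p i] := by
  rw [LinearIndependent.pair_iff]
  intro s t h
  have h1 := congrArg (G i) h
  have h2 := congrArg (G (τ.symm i)) h
  simp only [map_add, map_smul, map_sub, map_zero, smul_eq_mul, H.eq, H.eq_symm, sub_self,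
    mul_zero, zero_add, add_zero, mul_eq_zero] at h1 h2
  exact ⟨h2.resolve_right (sub_pos.2 (H.symm_lt_next i)).ne',
    h1.resolve_right (sub_pos.2 (H.lt_symm i)).ne'⟩

/-- Coordinates with respect to the two edges at a vertex. -/
theorem exists_coord (H : ConvexCycle τ p G) (i : ι) (x : Plane) :
    ∃ s t : ℝ, x - p i = s • (p (τ i) - p i) + t • (p (τ.symm i) - p i) ∧
      G (τ.symm i) x - G (τ.symm i) (p i) = s * (G (τ.symm i) (p (τ i)) - G (τ.symm i) (p i)) ∧
      G i x - G i (p i) = t * (G i (p (τ.symm i)) - G i (p i)) := by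
  have hspan := (H.linearIndependent i).span_eq_top_of_card_eq_finrank' (by simp)
  have hx : x - p i ∈ Submodule.span ℝ (range ![p (τ i) - p i, p (τ.symm i) - p i]) :=
    hspan ▸ Submodule.mem_top
  rw [Matrix.range_cons_cons_empty, Submodule.mem_span_pair] at hx
  obtain ⟨s, t, h⟩ := hx
  refine ⟨s, t, h.symm, ?_, ?_⟩
  · rw [← map_sub, ← h]
    simp [H.eq_symm]
  · rw [← map_sub, ← h]
    simp [H.eq]

theorem exists_coord_nonneg (H : ConvexCycle τ p G) (i : ι) {x : Plane}
    (h1 : G i (p i) ≤ G i x) (h2 : G (τ.symm i) (p i) ≤ G (τ.symm i) x) :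
    ∃ s t : ℝ, 0 ≤ s ∧ 0 ≤ t ∧ x - p i = s • (p (τ i) - p i) + t • (p (τ.symm i) - p i) := by
  obtain ⟨s, t, h, hs, ht⟩ := H.exists_coord i x
  refine ⟨s, t, ?_, ?_, h⟩
  · refine nonneg_of_mul_nonneg_left (hs ▸ sub_nonneg.2 h2) (sub_pos.2 (H.symm_lt_next i))
  · refine nonneg_of_mul_nonneg_left (ht ▸ sub_nonneg.2 h1) (sub_pos.2 (H.lt_symm i))

theorem exists_coord_pos (H : ConvexCycle τ p G) {i j : ι} (h0 : j ≠ i) (h1 : j ≠ τ i)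
    (h2 : j ≠ τ.symm i) :
    ∃ s t : ℝ, 0 < s ∧ 0 < t ∧ p j - p i = s • (p (τ i) - p i) + t • (p (τ.symm i) - p i) := by
  obtain ⟨s, t, h, hs, ht⟩ := H.exists_coord i (p j)
  refine ⟨s, t, ?_, ?_, h⟩
  · exact pos_of_mul_pos_left (hs ▸ sub_pos.2 (H.symm_lt h0 h2)) (sub_pos.2 (H.symm_lt_next i)).le
  · exact pos_of_mul_pos_left (ht ▸ sub_pos.2 (H.lt i j h0 h1)) (sub_pos.2 (H.lt_symm i)).le

/-- Every other vertex lies beyond the chord between the two neighbours of a vertex. -/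
theorem exists_coord_vertex (H : ConvexCycle τ p G) {i j : ι} (h0 : j ≠ i) :
    ∃ s t : ℝ, 0 ≤ s ∧ 0 ≤ t ∧ 1 ≤ s + t ∧
      p j - p i = s • (p (τ i) - p i) + t • (p (τ.symm i) - p i) := by
  obtain ⟨s, t, hs, ht, h⟩ := H.exists_coord_nonneg i (H.le i j) (H.symm_le i j)
  refine ⟨s, t, hs, ht, ?_, h⟩
  -- If s + t < 1, then p j is a convex combination of p i and its two neighbours with positive
  -- weight on p i. The functional exposing p j contradicts this.
  by_contra! hlt
  have hle : ∀ k, G j (p j) + G (τ.symm j) (p j) ≤ G j (p k) + G (τ.symm j) (p k) := fun k =>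
    add_le_add (H.le j k) (H.symm_le j k)
  have h1 := congrArg (G j + G (τ.symm j)) h
  simp only [LinearMap.add_apply, map_add, map_smul, map_sub, smul_eq_mul] at h1
  nlinarith [H.add_lt_add h0.symm, mul_le_mul_of_nonneg_left (hle (τ i)) hs,
    mul_le_mul_of_nonneg_left (hle (τ.symm i)) ht, mul_pos (sub_pos.2 hlt) (sub_pos.2 (H.add_lt_add h0.symm))]

theorem le_of_mem_convexHull (H : ConvexCycle τ p G) (i : ι) {x : Plane}
    (hx : x ∈ convexHull ℝ (range p)) : G i (p i) ≤ G i x := by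
  have : convexHull ℝ (range p) ⊆ {x | G i (p i) ≤ G i x} :=
    convexHull_min (by rintro _ ⟨j, rfl⟩; exact H.le i j)
      ((convex_Ici (G i (p i))).is_linear_preimage (G i).isLinear)
  exact this hx

theorem eq_of_mem_edge (H : ConvexCycle τ p G) {i : ι} {x : Plane}
    (hx : x ∈ segment ℝ (p i) (p (τ i))) : G i x = G i (p i) := by
  obtain ⟨a, b, -, -, hab, rfl⟩ := hx
  simp only [map_add, map_smul, smul_eq_mul, H.eq]
  rw [← add_mul, hab, one_mul]

theorem eq_or_eq_of_mem_edge (H : ConvexCycle τ p G) {i k : ι} (hik : k ≠ i) {x : Plane}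
    (hx : x ∈ segment ℝ (p k) (p (τ k))) (hi : x ∈ segment ℝ (p i) (p (τ i))) :
    x = p k ∨ x = p (τ k) := by
  have hGi := H.eq_of_mem_edge hi
  obtain ⟨a, b, ha, hb, hab, rfl⟩ := hx
  simp only [map_add, map_smul, smul_eq_mul] at hGi
  by_cases h : k = τ i
  · have h2 : τ k ≠ i := fun h' => H.ne_symm i (by rw [← h, ← h', τ.symm_apply_apply])
    have := H.lt i (τ k) h2 (fun h' => hik (τ.injective h'))
    have hk : G i (p k) = G i (p i) := by rw [h, H.eq]
    have hb0 : b * (G i (p (τ k)) - G i (p i)) = 0 := by rw [hk] at hGi; linear_combination hGi - G i (p i) * hab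
    have : b = 0 := (mul_eq_zero.1 hb0).resolve_right (sub_pos.2 this).ne'
    left; simp [this, show a = 1 by linarith]
  · have := H.lt i k hik h
    have ha0 : a * (G i (p k) - G i (p i)) ≤ 0 := by
      have e : a * G i (p i) + b * G i (p i) = G i (p i) := by rw [← add_mul, hab, one_mul]
      linarith [mul_le_mul_of_nonneg_left (H.le i (τ k)) hb, mul_sub a (G i (p k)) (G i (p i))]
    have : a = 0 := by
      by_contra hne
      have := mul_pos (lt_of_le_of_ne ha (Ne.symm hne)) (sub_pos.2 this)
      linarith
    right; simp [this, show b = 1 by linarith]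

theorem affineSpan_eq_top [Nonempty ι] (H : ConvexCycle τ p G) : affineSpan ℝ (range p) = ⊤ := by
  obtain ⟨i⟩ := ‹Nonempty ι›
  refine eq_top_iff.2 fun x _ => ?_
  obtain ⟨s, t, h, -, -⟩ := H.exists_coord i x
  have hm : ∀ j, p j ∈ affineSpan ℝ (range p) := fun j => subset_affineSpan ℝ _ ⟨j, rfl⟩
  have h1 := AffineSubspace.smul_vsub_vadd_mem _ t (hm (τ.symm i)) (hm i) (hm i)
  have h2 := AffineSubspace.smul_vsub_vadd_mem _ s (hm (τ i)) (hm i) h1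
  convert! h2 using 1
  simp only [vsub_eq_sub, vadd_eq_add]
  rw [← add_assoc, ← h, sub_add_cancel]

/-- Moving from an edge point against the direction of the other edge at p i lowers G i below its
minimum on the hull. -/
theorem edge_subset_frontier (H : ConvexCycle τ p G) (i : ι) :
    segment ℝ (p i) (p (τ i)) ⊆ frontier (convexHull ℝ (range p)) := by
  intro x hx
  have hmem : x ∈ convexHull ℝ (range p) :=
    (convex_convexHull ℝ _).segment_subset (subset_convexHull ℝ _ (mem_range_self i))
      (subset_convexHull ℝ _ (mem_range_self _)) hx
  refine ⟨subset_closure hmem, fun hint => ?_⟩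
  have hlim : Tendsto (fun ε : ℝ => x - ε • (p (τ.symm i) - p i)) (𝓝[>] 0) (𝓝 x) := by
    have : Continuous (fun ε : ℝ => x - ε • (p (τ.symm i) - p i)) := by fun_prop
    simpa using (this.tendsto 0).mono_left nhdsWithin_le_nhds
  obtain ⟨ε, hε, hε0⟩ := ((hlim.eventually (mem_interior_iff_mem_nhds.1 hint)).and
    self_mem_nhdsWithin).exists
  have h1 := H.le_of_mem_convexHull i hε
  simp only [map_sub, map_smul, smul_eq_mul, H.eq_of_mem_edge hx] at h1
  nlinarith [mul_pos (show 0 < ε from hε0) (sub_pos.2 (H.lt_symm i))]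

variable [Fintype ι]

/-- A functional f supporting the hull at x is maximal at every vertex of positive weight in a
convex representation of x. Its maximal vertices are pairwise adjacent and never three in a row, so
these weights sit on one edge. -/
theorem frontier_subset [Nonempty ι] (H : ConvexCycle τ p G) :
    frontier (convexHull ℝ (range p)) ⊆ ⋃ i, segment ℝ (p i) (p (τ i)) := by
  classical
  intro x hx
  have hclosed : IsClosed (convexHull ℝ (range p)) := (finite_range p).isClosed_convexHull ℝ
  have hconv := convex_convexHull ℝ (range p)
  have hne := interior_convexHull_nonempty_iff_affineSpan_eq_top.2 H.affineSpan_eq_top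
  obtain ⟨f, hf⟩ := geometric_hahn_banach_open_point hconv.interior isOpen_interior hx.2
  have hle : ∀ i, f (p i) ≤ f x := fun i => by
    have h1 : p i ∈ closure (interior (convexHull ℝ (range p))) := by
      rw [hconv.closure_interior_eq_closure_of_nonempty_interior hne]
      exact subset_closure (subset_convexHull ℝ _ (mem_range_self i))
    exact closure_minimal (fun a ha => (hf a ha).le) (isClosed_le f.continuous continuous_const) h1
  -- If f agrees at a vertex and both its neighbours, it is constant on the plane, contradicting
  -- strict separation from an interior point.
  have hzero : ∀ i, f (p i) = f x → f (p (τ i)) = f x → f (p (τ.symm i)) = f x → False := by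
    intro i h0 h1 h2
    obtain ⟨a, ha⟩ := hne
    obtain ⟨s, t, h, -, -⟩ := H.exists_coord i a
    have := congrArg f h
    simp only [map_sub, map_add, map_smul, smul_eq_mul, h0, h1, h2] at this
    have := hf a ha
    linarith
  -- A non-adjacent vertex is p i plus a strictly positive combination of the edge vectors, so
  -- maximality there forces maximality at both neighbours.
  have hadj : ∀ i j, f (p i) = f x → f (p j) = f x → j = i ∨ j = τ i ∨ j = τ.symm i := by
    intro i j hi hj
    by_contra! hne
    obtain ⟨s, t, hs, ht, h⟩ := H.exists_coord_pos hne.1 hne.2.1 hne.2.2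
    have := congrArg f h
    simp only [map_sub, map_add, map_smul, smul_eq_mul, hi, hj, sub_self] at this
    have h1 := hle (τ i)
    have h2 := hle (τ.symm i)
    refine hzero i hi ?_ ?_
    · nlinarith [mul_nonneg ht.le (sub_nonneg.2 h2), mul_nonneg hs.le (sub_nonneg.2 h1)]
    · nlinarith [mul_nonneg ht.le (sub_nonneg.2 h2), mul_nonneg hs.le (sub_nonneg.2 h1)]
  have hxm : x ∈ convexHull ℝ (range p) := hclosed.frontier_subset hx
  obtain ⟨w, ⟨hw0, hw1⟩, hwx⟩ := exists_weights_of_mem_convexHull_range hxm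
  have hsupp : ∀ i, w i ≠ 0 → f (p i) = f x := by
    have hsum : ∑ i, w i * (f x - f (p i)) = 0 := by
      have := congrArg f hwx
      simp only [map_sum, map_smul, smul_eq_mul] at this
      simp only [mul_sub, Finset.sum_sub_distrib, ← Finset.sum_mul, hw1, this, one_mul, sub_self]
    intro i hi
    have := (Finset.sum_eq_zero_iff_of_nonneg fun i _ =>
      mul_nonneg (hw0 i) (sub_nonneg.2 (hle i))).1 hsum i (Finset.mem_univ i)
    linarith [(mul_eq_zero.1 this).resolve_left hi]
  obtain ⟨i, hi⟩ : ∃ i, ∀ k, k ≠ i → k ≠ τ i → w k = 0 := by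
    have two : ∀ i, f (p i) = f x → f (p (τ i)) = f x → ∀ k, k ≠ i → k ≠ τ i → w k = 0 := by
      intro i h0 h1 k hk0 hk1
      by_contra hk
      have hk' := hsupp k hk
      rcases hadj i k h0 hk' with h | h | h
      · exact hk0 h
      · exact hk1 h
      · exact hzero i h0 h1 (h ▸ hk')
    obtain ⟨i, -, hi⟩ : ∃ i ∈ Finset.univ, w i ≠ 0 :=
      Finset.exists_ne_zero_of_sum_ne_zero (by rw [hw1]; exact one_ne_zero)
    have hi' := hsupp i hi
    by_cases h1 : f (p (τ i)) = f x
    · exact ⟨i, two i hi' h1⟩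
    by_cases h2 : f (p (τ.symm i)) = f x
    · exact ⟨τ.symm i, two _ h2 (by simpa using hi')⟩
    refine ⟨i, fun k hk0 hk1 => ?_⟩
    by_contra hk
    have hk' := hsupp k hk
    rcases hadj i k hi' hk' with h | h | h
    · exact hk0 h
    · exact hk1 h
    · exact h2 (h ▸ hk')
  refine mem_iUnion.2 ⟨i, w i, w (τ i), hw0 _, hw0 _, ?_, ?_⟩
  · rw [← hw1, Fintype.sum_eq_add i (τ i) (H.ne i).symm fun k hk => hi k hk.1 hk.2]
  · rw [← hwx, Fintype.sum_eq_add i (τ i) (H.ne i).symm fun k hk => by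
      rw [hi k hk.1 hk.2, zero_smul]]

theorem frontier_eq [Nonempty ι] (H : ConvexCycle τ p G) :
    frontier (convexHull ℝ (range p)) = ⋃ i, segment ℝ (p i) (p (τ i)) :=
  H.frontier_subset.antisymm (iUnion_subset H.edge_subset_frontier)

end ConvexCycle

/-! ### Strictly convex polygons provide such functionals. -/

namespace Polygon

/-- Up to a positive factor, the distance to the line through the `i`-th edge, with a sign. -/
def edgeForm (u : Plane) : Plane →ₗ[ℝ] ℝ where
  toFun x := u 0 * x 1 - u 1 * x 0
  map_add' x y := by simp; ring
  map_smul' c x := by simp; ring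

theorem edgeForm_apply (u x : Plane) : edgeForm u x = u 0 * x 1 - u 1 * x 0 := rfl

theorem eq_smul_of_edgeForm_eq_zero {u x : Plane} (hu : u ≠ 0) (h : edgeForm u x = 0) :
    ∃ t : ℝ, x = t • u := by
  rw [edgeForm_apply] at h
  by_cases h0 : u 0 = 0
  · have h1 : u 1 ≠ 0 := fun h1 => hu (by ext k; fin_cases k <;> simp [h0, h1])
    refine ⟨x 1 / u 1, ?_⟩
    have : x 0 = 0 := by
      rw [h0, zero_mul, zero_sub, neg_eq_zero] at h
      exact (mul_eq_zero.1 h).resolve_left h1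
    ext k; fin_cases k
    · simp [h0, this]
    · simp; field_simp
  · refine ⟨x 0 / u 0, ?_⟩
    ext k; fin_cases k
    · simp; field_simp
    · simp; field_simp; linarith

/-- The form vanishes precisely on the direction of the line, so it depends only on displacement
from the line; the common ray forces equal signs. -/
theorem edgeForm_mul_pos {a b x y : Plane} (hab : a ≠ b) (h : (line[ℝ, a, b]).SSameSide x y) :
    0 < edgeForm (b - a) (x - a) * edgeForm (b - a) (y - a) := by
  obtain ⟨⟨p₁, h₁, p₂, h₂, hray⟩, hx, hy⟩ := h
  have hne : ∀ z, z ∉ line[ℝ, a, b] → edgeForm (b - a) (z - a) ≠ 0 := fun z hz h0 => by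
    obtain ⟨t, ht⟩ := eq_smul_of_edgeForm_eq_zero (sub_ne_zero.2 hab.symm) h0
    refine hz ?_
    rw [show z = AffineMap.lineMap a b t by
      rw [AffineMap.lineMap_apply, vsub_eq_sub, ← ht, vadd_eq_add, sub_add_cancel]]
    exact AffineMap.lineMap_mem_affineSpan_pair t a b
  have hval : ∀ z q, q ∈ line[ℝ, a, b] → edgeForm (b - a) (z - q) = edgeForm (b - a) (z - a) := by
    rintro z q hq
    obtain ⟨t, rfl⟩ := mem_affineSpan_pair_iff_exists_lineMap_eq.1 hq
    have : edgeForm (b - a) (b - a) = 0 := by rw [edgeForm_apply]; ring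
    rw [AffineMap.lineMap_apply, vsub_eq_sub, vadd_eq_add, show z - (t • (b - a) + a) =
      (z - a) - t • (b - a) by abel, map_sub, map_smul, this, smul_zero, sub_zero]
  have h3 := hray.map (edgeForm (b - a))
  rw [vsub_eq_sub, vsub_eq_sub, hval x p₁ h₁, hval y p₂ h₂] at h3
  refine lt_of_le_of_ne ?_ (mul_ne_zero (hne x hx) (hne y hy)).symm
  obtain ⟨r, s, hr, hs, h4⟩ := h3.exists_pos (hne x hx) (hne y hy)
  simp only [smul_eq_mul] at h4
  refine nonneg_of_mul_nonneg_right (a := r) ?_ hr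
  rw [← mul_assoc, h4, mul_assoc]
  exact mul_nonneg hs.le (mul_self_nonneg _)

theorem IsStrictlyConvex.exists_convexCycle {M : ℕ} (hM : 3 ≤ M) {p : Polygon Plane M}
    (hp : p.IsStrictlyConvex) : ∃ G, ConvexCycle (finRotate M) p.vertices G := by
  obtain ⟨m, rfl⟩ : ∃ m, M = m + 3 := ⟨M - 3, by omega⟩
  set τ := finRotate (m + 3)
  have hτ : ∀ i, (τ i : ℕ) = (i + 1) % (m + 3) := fun i => by
    simp [τ, Fin.val_add]
  have hne : ∀ i, τ i ≠ i := fun i h => by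
    have := congrArg Fin.val h
    rw [hτ] at this
    have hi := i.2
    rcases Nat.lt_or_ge (i + 1) (m + 3) with h | h
    · rw [Nat.mod_eq_of_lt h] at this; omega
    · rw [show (i : ℕ) + 1 = m + 3 by omega, Nat.mod_self] at this; omega
  have hne2 : ∀ i, τ (τ i) ≠ i := fun i h => by
    have := congrArg Fin.val h
    rw [hτ, hτ, Nat.mod_add_mod] at this
    have hi := i.2
    rcases Nat.lt_or_ge (i + 1 + 1) (m + 3) with h | h
    · rw [Nat.mod_eq_of_lt h] at this; omega
    · rw [Nat.mod_eq_sub_mod h, Nat.mod_eq_of_lt (by omega)] at this; omega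
  have hpne : ∀ i, p i ≠ p (τ i) := fun i h => by
    have h1 := (hp (τ i) i i (hne i).symm (hne2 i).symm (hne i).symm (hne2 i).symm).left_notMem
    rw [h] at h1
    exact h1 (left_mem_affineSpan_pair ℝ _ _)
  -- Multiplying by the value at the vertex after next makes the functional positive on the
  -- polygon's side, whatever the orientation.
  refine ⟨fun i => edgeForm (p (τ i) - p i) (p (τ (τ i)) - p i) • edgeForm (p (τ i) - p i),
    hne, fun i h => hne2 i ?_, fun i => ?_, fun i j h1 h2 => ?_⟩
  · rw [h, τ.apply_symm_apply]
  · rw [← sub_eq_zero, ← map_sub, LinearMap.smul_apply, edgeForm_apply (p (τ i) - p i) (p (τ i) - p i),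
      mul_comm, sub_self, smul_zero]
  · rw [← sub_pos, ← map_sub, LinearMap.smul_apply, smul_eq_mul]
    exact edgeForm_mul_pos (hpne i) (hp i _ _ (hne2 i) (fun h => hne _ h) h1 h2)

end Polygon

/-! ### Length measure on the boundary with edge ends removed. -/

section EdgeMeasure

theorem mem_segment_iff_exists_lineMap {a b q : Plane} :
    q ∈ segment ℝ a b ↔ ∃ t ∈ Icc (0 : ℝ) 1, AffineMap.lineMap a b t = q := by
  rw [segment_eq_image_lineMap, mem_image]

/-- The part of a segment at distance more than `x` and `y` from its two endpoints. -/
def trimmedSegment (a b : Plane) (x y : ℝ) : Set Plane :=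
  {q | q ∈ segment ℝ a b ∧ x < dist q a ∧ y < dist q b}

theorem measurableSet_segment (a b : Plane) : MeasurableSet (segment ℝ a b) := by
  rw [← convexHull_pair]
  exact ((toFinite {a, b}).isClosed_convexHull ℝ).measurableSet

theorem measurableSet_trimmedSegment (a b : Plane) (x y : ℝ) :
    MeasurableSet (trimmedSegment a b x y) :=
  (measurableSet_segment a b).inter
    ((measurableSet_lt measurable_const (measurable_id.dist measurable_const)).inter
      (measurableSet_lt measurable_const (measurable_id.dist measurable_const)))

/-- The affine parametrisation scales length by `dist a b`; truncation in `ENNReal.ofReal` covers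
the case where nothing remains. -/
theorem hausdorffMeasure_trimmedSegment {a b : Plane} (hab : a ≠ b) {x y : ℝ} (hx : 0 ≤ x)
    (hy : 0 ≤ y) :
    Measure.hausdorffMeasure 1 (trimmedSegment a b x y) = ENNReal.ofReal (dist a b - x - y) := by
  have hd : 0 < dist a b := dist_pos.2 hab
  have e : trimmedSegment a b x y =
      AffineMap.lineMap a b '' Ioo (x / dist a b) (1 - y / dist a b) := by
    ext q
    simp only [trimmedSegment, mem_ofPred_eq, mem_segment_iff_exists_lineMap, mem_image]
    constructor
    · rintro ⟨⟨t, ⟨ht0, ht1⟩, rfl⟩, h1, h2⟩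
      rw [dist_lineMap_left, Real.norm_of_nonneg ht0] at h1
      rw [dist_lineMap_right, Real.norm_of_nonneg (by linarith)] at h2
      refine ⟨t, ⟨by rwa [div_lt_iff₀ hd], ?_⟩, rfl⟩
      rw [lt_sub_comm, div_lt_iff₀ hd]; exact h2
    · rintro ⟨t, ⟨h1, h2⟩, rfl⟩
      have hx0 : 0 ≤ x / dist a b := by positivity
      have hy0 : 0 ≤ y / dist a b := by positivity
      refine ⟨⟨t, ⟨by linarith, by linarith⟩, rfl⟩, ?_, ?_⟩
      · rw [dist_lineMap_left, Real.norm_of_nonneg (by linarith)]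
        rwa [div_lt_iff₀ hd] at h1
      · rw [dist_lineMap_right, Real.norm_of_nonneg (by linarith)]
        rwa [lt_sub_comm, div_lt_iff₀ hd] at h2
  rw [e, hausdorffMeasure_lineMap_image, hausdorffMeasure_real, Real.volume_Ioo, ENNReal.smul_def,
    smul_eq_mul, ← ENNReal.ofReal_coe_nnreal, coe_nndist, ← ENNReal.ofReal_mul hd.le]
  congr 1
  field_simp
  ring

end EdgeMeasure

/-- The vertex from which each edge starts, when every edge is counted once from each end. -/
def edgeBase {ι : Type*} : ι ⊕ ι → ι := Sum.elim id id

/-- The other end of each edge. -/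
def edgeEnd {ι : Type*} (τ : Equiv.Perm ι) : ι ⊕ ι → ι := Sum.elim τ τ.symm

/-- The length of each edge. -/
noncomputable def edgeLength {ι : Type*} (τ : Equiv.Perm ι) (p : ι → Plane) (k : ι ⊕ ι) : ℝ :=
  dist (p (edgeBase k)) (p (edgeEnd τ k))

open Classical in
/-- The distance to the start of an edge along that edge, and the edge length elsewhere. -/
noncomputable def edgeCoord {ι : Type*} (τ : Equiv.Perm ι) (p : ι → Plane) (k : ι ⊕ ι)
    (q : Plane) : ℝ :=
  if q ∈ segment ℝ (p (edgeBase k)) (p (edgeEnd τ k)) then dist q (p (edgeBase k))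
  else edgeLength τ p k

/-- The total length of a closed polygonal path. -/
noncomputable def cycleLength {ι : Type*} [Fintype ι] (τ : Equiv.Perm ι) (p : ι → Plane) : ℝ :=
  ∑ i, dist (p i) (p (τ i))

/-- The uniform distribution on the boundary of the convex hull of finitely many points. -/
noncomputable def boundaryMeasure {ι : Type*} (p : ι → Plane) : Measure Plane :=
  (Measure.hausdorffMeasure 1)[|frontier (convexHull ℝ (range p))]

theorem measurable_edgeCoord {ι : Type*} (τ : Equiv.Perm ι) (p : ι → Plane) (k : ι ⊕ ι) :
    Measurable (edgeCoord τ p k) := by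
  classical
  unfold edgeCoord
  exact Measurable.ite (measurableSet_segment _ _) (by fun_prop) measurable_const

theorem edgeCoord_nonneg {ι : Type*} (τ : Equiv.Perm ι) (p : ι → Plane) (k : ι ⊕ ι) (q : Plane) :
    0 ≤ edgeCoord τ p k q := by
  unfold edgeCoord edgeLength
  split_ifs <;> exact dist_nonneg

namespace ConvexCycle

variable {ι : Type*} {τ : Equiv.Perm ι} {p : ι → Plane} {G : ι → Plane →ₗ[ℝ] ℝ}

theorem edgeEnd_ne (H : ConvexCycle τ p G) (k : ι ⊕ ι) : edgeEnd τ k ≠ edgeBase k := by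
  rcases k with i | i
  · exact H.ne i
  · exact H.symm_ne i

theorem edgeLength_pos (H : ConvexCycle τ p G) (k : ι ⊕ ι) : 0 < edgeLength τ p k :=
  dist_pos.2 fun h => H.edgeEnd_ne k (H.injective h).symm

/-- Distinct edges meet only in vertices, and the strict inequalities remove both ends even when x =
y = 0. -/
theorem disjoint_trimmedSegment_edge (H : ConvexCycle τ p G) {i j : ι} (hij : i ≠ j) {x y : ℝ}
    (hx : 0 ≤ x) (hy : 0 ≤ y) {q : Plane} (hq : q ∈ trimmedSegment (p i) (p (τ i)) x y) :
    q ∉ segment ℝ (p j) (p (τ j)) := by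
  intro hj
  rcases H.eq_or_eq_of_mem_edge hij hq.1 hj with rfl | rfl
  · have := hq.2.1; rw [dist_self] at this; linarith
  · have := hq.2.2; rw [dist_self] at this; linarith

variable [Fintype ι]

/-- A point constrains only the edge it lies on, seen from its ends through `Sum.inl i` and `Sum.inr
(τ i)`; off that edge the default value of the coordinate exceeds x k. -/
theorem frontier_inter_lt_edgeCoord [Nonempty ι] (H : ConvexCycle τ p G) {x : ι ⊕ ι → ℝ} (hx : ∀ k, 0 ≤ x k)
    (hlt : ∀ k, x k < edgeLength τ p k) :
    frontier (convexHull ℝ (range p)) ∩ {q | ∀ k, x k < edgeCoord τ p k q} =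
      ⋃ i, trimmedSegment (p i) (p (τ i)) (x (Sum.inl i)) (x (Sum.inr (τ i))) := by
  ext q
  rw [H.frontier_eq]
  simp only [mem_inter_iff, mem_iUnion, mem_ofPred_eq]
  constructor
  · rintro ⟨⟨i, hi⟩, h⟩
    refine ⟨i, hi, ?_, ?_⟩
    · have := h (Sum.inl i)
      rwa [edgeCoord, if_pos (by simpa [edgeBase, edgeEnd] using hi)] at this
    · have := h (Sum.inr (τ i))
      rwa [edgeCoord, if_pos (by simpa [edgeBase, edgeEnd, segment_symm] using hi)] at this
  · rintro ⟨i, hi⟩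
    refine ⟨⟨i, hi.1⟩, fun k => ?_⟩
    unfold edgeCoord
    split_ifs with hk
    · rcases k with j | j
      · have hij : i = j := by
          by_contra hne
          exact H.disjoint_trimmedSegment_edge hne (hx _) (hx _) hi hk
        subst hij
        exact hi.2.1
      · have hij : i = τ.symm j := by
          by_contra hne
          refine H.disjoint_trimmedSegment_edge hne (hx _) (hx _) hi ?_
          rw [segment_symm, τ.apply_symm_apply]
          exact hk
        subst hij
        have := hi.2.2
        simpa [edgeBase] using this
    · exact hlt k

theorem hausdorffMeasure_iUnion_trimmedSegment (H : ConvexCycle τ p G) {x : ι ⊕ ι → ℝ}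
    (hx : ∀ k, 0 ≤ x k)
    (hlt : ∀ i, x (Sum.inl i) + x (Sum.inr (τ i)) ≤ dist (p i) (p (τ i))) :
    Measure.hausdorffMeasure 1
      (⋃ i, trimmedSegment (p i) (p (τ i)) (x (Sum.inl i)) (x (Sum.inr (τ i)))) =
      ENNReal.ofReal (cycleLength τ p - ∑ k, x k) := by
  rw [measure_iUnion _ fun i => measurableSet_trimmedSegment _ _ _ _, tsum_fintype]
  · rw [Finset.sum_congr rfl fun i _ => hausdorffMeasure_trimmedSegment
      (fun h => H.ne i (H.injective h).symm) (hx _) (hx _),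
      ← ENNReal.ofReal_sum_of_nonneg fun i _ => by linarith [hlt i]]
    congr 1
    rw [Finset.sum_sub_distrib, Finset.sum_sub_distrib, Fintype.sum_sum_type,
      Equiv.sum_comp τ fun i => x (Sum.inr i), cycleLength]
    ring
  · intro i j hij
    refine Set.disjoint_left.2 fun q hi hj => ?_
    exact H.disjoint_trimmedSegment_edge hij (hx _) (hx _) hi hj.1

variable [Nonempty ι]

theorem cycleLength_pos (H : ConvexCycle τ p G) : 0 < cycleLength τ p :=
  Finset.sum_pos (fun i _ => H.edgeLength_pos (Sum.inl i)) Finset.univ_nonempty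

theorem hausdorffMeasure_frontier (H : ConvexCycle τ p G) :
    Measure.hausdorffMeasure 1 (frontier (convexHull ℝ (range p))) =
      ENNReal.ofReal (cycleLength τ p) := by
  have h := H.hausdorffMeasure_iUnion_trimmedSegment (x := 0) (fun _ => le_rfl)
    (fun i => by simp)
  simp only [Pi.zero_apply, Finset.sum_const_zero, sub_zero] at h
  rw [← h, H.frontier_eq]
  refine measure_eq_measure_of_null_sdiff (iUnion_mono fun i q hq => hq.1)
    (measure_mono_null (t := range p) ?_ ?_) |>.symm
  swap
  · have := Measure.nullSingletonClass_hausdorff Plane one_pos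
    exact (finite_range p).measure_zero _
  rintro q ⟨hq, hq'⟩
  obtain ⟨i, hi⟩ := mem_iUnion.1 hq
  by_contra hr
  refine hq' (mem_iUnion.2 ⟨i, hi, dist_pos.2 ?_, dist_pos.2 ?_⟩)
  · rintro rfl; exact hr ⟨i, rfl⟩
  · rintro rfl; exact hr ⟨τ i, rfl⟩

theorem isProbabilityMeasure_boundaryMeasure (H : ConvexCycle τ p G) :
    IsProbabilityMeasure (boundaryMeasure p) := by
  refine cond_isProbabilityMeasure_of_finite ?_ ?_
  · rw [H.hausdorffMeasure_frontier]; simpa using H.cycleLength_pos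
  · rw [H.hausdorffMeasure_frontier]; exact ENNReal.ofReal_ne_top

theorem boundaryMeasure_lt_edgeCoord (H : ConvexCycle τ p G) {x : ι ⊕ ι → ℝ} (hx : ∀ k, 0 ≤ x k)
    (hlt : ∀ k, x k < edgeLength τ p k)
    (hle : ∀ i, x (Sum.inl i) + x (Sum.inr (τ i)) ≤ dist (p i) (p (τ i))) :
    (boundaryMeasure p).real {q | ∀ k, x k < edgeCoord τ p k q} =
      1 - (∑ k, x k) / cycleLength τ p := by
  have hL := H.cycleLength_pos
  have hsum : 0 ≤ cycleLength τ p - ∑ k, x k := by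
    rw [Fintype.sum_sum_type, ← Equiv.sum_comp τ fun i => x (Sum.inr i), ← Finset.sum_add_distrib,
      cycleLength, sub_nonneg]
    exact Finset.sum_le_sum fun i _ => hle i
  rw [Measure.real, boundaryMeasure, cond_apply isClosed_frontier.measurableSet,
    H.frontier_inter_lt_edgeCoord hx hlt, H.hausdorffMeasure_iUnion_trimmedSegment hx hle,
    H.hausdorffMeasure_frontier, ENNReal.toReal_mul, ENNReal.toReal_inv,
    ENNReal.toReal_ofReal hL.le, ENNReal.toReal_ofReal hsum]
  field_simp

end ConvexCycle

theorem ae_mem_frontier_boundaryMeasure {ι : Type*} (p : ι → Plane) :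
    ∀ᵐ q ∂(boundaryMeasure p), q ∈ frontier (convexHull ℝ (range p)) :=
  ae_cond_mem isClosed_frontier.measurableSet

/-! ### Joint law of the nearest distances. -/

/-- The least edge coordinates in a finite configuration of points. -/
noncomputable def nearest {ι : Type*} (τ : Equiv.Perm ι) (p : ι → Plane) {n : ℕ}
    (x : Fin n → Plane) (k : ι ⊕ ι) : ℝ :=
  ⨅ j, edgeCoord τ p k (x j)

theorem measurable_nearest {ι : Type*} (τ : Equiv.Perm ι) (p : ι → Plane) (n : ℕ) :
    Measurable fun (x : Fin n → Plane) => nearest τ p x :=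
  measurable_pi_lambda _ fun k => Measurable.iInf fun j =>
    (measurable_edgeCoord τ p k).comp (measurable_pi_apply j)

theorem lt_nearest_iff {ι : Type*} {τ : Equiv.Perm ι} {p : ι → Plane} {n : ℕ} [NeZero n]
    {x : Fin n → Plane} {k : ι ⊕ ι} {a : ℝ} :
    a < nearest τ p x k ↔ ∀ j, a < edgeCoord τ p k (x j) := by
  constructor
  · exact fun h j => h.trans_le (ciInf_le (finite_range _).bddBelow j)
  · intro h
    obtain ⟨j, hj⟩ := exists_eq_ciInf_of_finite (f := fun j => edgeCoord τ p k (x j))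
    rw [nearest, ← hj]; exact h j

namespace ConvexCycle

variable {ι : Type*} {τ : Equiv.Perm ι} {p : ι → Plane} {G : ι → Plane →ₗ[ℝ] ℝ}
  [Fintype ι] [Nonempty ι]

theorem measureReal_lt_nearest (H : ConvexCycle τ p G) (n : ℕ) [NeZero n] {x : ι ⊕ ι → ℝ}
    (hx : ∀ k, 0 ≤ x k) (hlt : ∀ k, x k < edgeLength τ p k)
    (hle : ∀ i, x (Sum.inl i) + x (Sum.inr (τ i)) ≤ dist (p i) (p (τ i))) :
    (Measure.pi fun _ : Fin n => boundaryMeasure p).real {z | ∀ k, x k < nearest τ p z k} =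
      (1 - (∑ k, x k) / cycleLength τ p) ^ n := by
  have := H.isProbabilityMeasure_boundaryMeasure
  have e : {z : Fin n → Plane | ∀ k, x k < nearest τ p z k} =
      univ.pi fun _ => {q | ∀ k, x k < edgeCoord τ p k q} := by
    ext z
    simp only [lt_nearest_iff, mem_ofPred_eq, mem_univ_pi]
    exact forall_comm
  rw [e, Measure.real, Measure.pi_pi, ENNReal.toReal_prod, Finset.prod_const, Finset.card_univ,
    Fintype.card_fin, ← H.boundaryMeasure_lt_edgeCoord hx hlt hle, Measure.real]

theorem ae_nearest_pos (H : ConvexCycle τ p G) (n : ℕ) [NeZero n] :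
    ∀ᵐ z ∂(Measure.pi fun _ : Fin n => boundaryMeasure p), ∀ k, 0 < nearest τ p z k := by
  have := H.isProbabilityMeasure_boundaryMeasure
  have h := H.measureReal_lt_nearest n (x := 0) (fun _ => le_rfl) H.edgeLength_pos (fun i => by simp)
  simp only [Pi.zero_apply, Finset.sum_const_zero, zero_div, sub_zero, one_pow] at h
  rw [Measure.real, ENNReal.toReal_eq_one_iff] at h
  refine (mem_ae_iff_prob_eq_one ?_).2 h
  rw [ofPred_forall]
  exact MeasurableSet.iInter fun k => measurableSet_lt measurable_const
    ((measurable_pi_apply k).comp (measurable_nearest τ p n))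

theorem measureReal_lt_nearest_single (H : ConvexCycle τ p G) (n : ℕ) [NeZero n] (k : ι ⊕ ι) {t : ℝ}
    (ht : 0 ≤ t) (hlt : t < edgeLength τ p k) :
    (Measure.pi fun _ : Fin n => boundaryMeasure p).real {z | t < nearest τ p z k} =
      (1 - t / cycleLength τ p) ^ n := by
  classical
  -- Level 0 for the other coordinates costs nothing, since all nearest distances are almost surely
  -- positive.
  have h := H.measureReal_lt_nearest n (x := Pi.single k t) ?_ ?_ ?_
  · rw [Finset.sum_pi_single', if_pos (Finset.mem_univ k)] at h
    rw [← h]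
    refine measureReal_congr ?_
    filter_upwards [H.ae_nearest_pos n] with z hz
    refine propext ⟨fun (h : t < nearest τ p z k) j => ?_, fun h => ?_⟩
    · by_cases hj : j = k
      · subst hj; simpa using h
      · simpa [hj] using hz j
    · show t < nearest τ p z k
      simpa using h k
  · intro j
    by_cases hj : j = k
    · subst hj; simpa using ht
    · simp [hj]
  · intro j
    by_cases hj : j = k
    · subst hj; simpa using hlt
    · simpa [hj] using H.edgeLength_pos j
  · intro i
    rcases k with j | j
    · by_cases hj : i = j
      · subst hj; simpa [edgeLength, edgeBase, edgeEnd] using hlt.le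
      · simp [hj]
    · by_cases hj : τ i = j
      · subst hj; simpa [edgeLength, edgeBase, edgeEnd, dist_comm] using hlt.le
      · simp [hj]

end ConvexCycle

/-! ### Hausdorff distance between convex hulls. -/

section HullDistance

theorem mem_cthickening_iff_infDist_le {C : Set Plane} (hne : C.Nonempty) {R : ℝ} (hR : 0 ≤ R)
    {y : Plane} : y ∈ Metric.cthickening R C ↔ Metric.infDist y C ≤ R := by
  rw [Metric.mem_cthickening_iff, ENNReal.le_ofReal_iff_toReal_le (Metric.infEDist_ne_top hne) hR,
    Metric.infDist]

theorem convexHull_range_nonempty {ι : Type*} [Nonempty ι] (x : ι → Plane) :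
    (convexHull ℝ (range x)).Nonempty := (range_nonempty x).convexHull

theorem isBounded_convexHull_range {ι : Type*} [Finite ι] (x : ι → Plane) :
    Bornology.IsBounded (convexHull ℝ (range x)) :=
  isBounded_convexHull.2 (finite_range x).isBounded

theorem infDist_le_of_mem_convexHull_range {ι : Type*} {p : ι → Plane} {C : Set Plane}
    (hC : Convex ℝ C) (hne : C.Nonempty) {R : ℝ} (hR : 0 ≤ R)
    (h : ∀ i, Metric.infDist (p i) C ≤ R) {y : Plane} (hy : y ∈ convexHull ℝ (range p)) :
    Metric.infDist y C ≤ R := by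
  rw [← mem_cthickening_iff_infDist_le hne hR]
  refine convexHull_min ?_ (hC.cthickening R) hy
  rintro _ ⟨i, rfl⟩
  exact (mem_cthickening_iff_infDist_le hne hR).2 (h i)

variable {ι : Type*} [Finite ι] [Nonempty ι] {n : ℕ} [NeZero n]

theorem hausdorffEDist_convexHull_ne_top {ι' : Type*} [Finite ι'] [Nonempty ι']
    (p : ι → Plane) (x : ι' → Plane) :
    Metric.hausdorffEDist (convexHull ℝ (range p)) (convexHull ℝ (range x)) ≠ ⊤ :=
  Metric.hausdorffEDist_ne_top_of_nonempty_of_bounded (convexHull_range_nonempty _)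
    (convexHull_range_nonempty _) (isBounded_convexHull_range _) (isBounded_convexHull_range _)

theorem hausdorffDist_convexHull_range_le {ι : Type*} [Fintype ι] [Nonempty ι] (x y : ι → Plane) :
    Metric.hausdorffDist (convexHull ℝ (range x)) (convexHull ℝ (range y)) ≤ dist x y := by
  have key : ∀ x y : ι → Plane, ∀ i,
      Metric.infDist (x i) (convexHull ℝ (range y)) ≤ dist x y := fun x y i =>
    (Metric.infDist_le_dist_of_mem (subset_convexHull ℝ _ (mem_range_self i))).trans
      (dist_le_pi_dist x y i)
  refine Metric.hausdorffDist_le_of_infDist dist_nonneg (fun z hz => ?_) fun z hz => ?_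
  · exact infDist_le_of_mem_convexHull_range (convex_convexHull ℝ _) (convexHull_range_nonempty _)
      dist_nonneg (key x y) hz
  · exact infDist_le_of_mem_convexHull_range (convex_convexHull ℝ _) (convexHull_range_nonempty _)
      dist_nonneg (fun i => dist_comm x y ▸ key y x i) hz

theorem continuous_hullDistance (p : ι → Plane) :
    Continuous fun x : Fin n → Plane => hullDistance (convexHull ℝ (range p)) x := by
  refine (LipschitzWith.of_le_add (f := fun x : Fin n → Plane =>
    hullDistance (convexHull ℝ (range p)) x) fun x y => ?_).continuous
  refine (Metric.hausdorffDist_triangle (t := convexHull ℝ (range y))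
    (hausdorffEDist_convexHull_ne_top p y)).trans ?_
  rw [dist_comm]
  exact add_le_add le_rfl (hausdorffDist_convexHull_range_le y x)

/-- The sample hull lies inside the polygon, so only distances from polygon points count. Closed
thickenings of a convex set are convex, so a bound at the vertices holds throughout. -/
theorem lt_hullDistance_iff {p : ι → Plane} {x : Fin n → Plane}
    (hx : ∀ j, x j ∈ convexHull ℝ (range p)) {r : ℝ} (hr : 0 ≤ r) :
    r < hullDistance (convexHull ℝ (range p)) x ↔
      ∃ i, r < Metric.infDist (p i) (convexHull ℝ (range x)) := by
  constructor
  · intro h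
    by_contra! hle
    refine h.not_ge (Metric.hausdorffDist_le_of_infDist hr (fun y hy =>
      infDist_le_of_mem_convexHull_range (convex_convexHull ℝ _) (convexHull_range_nonempty x) hr
        hle hy) fun y hy => ?_)
    rw [Metric.infDist_zero_of_mem]
    · exact hr
    · exact convexHull_min (by rintro _ ⟨j, rfl⟩; exact hx j) (convex_convexHull ℝ _) hy
  · rintro ⟨i, hi⟩
    exact hi.trans_le (Metric.infDist_le_hausdorffDist_of_mem
      (subset_convexHull ℝ _ (mem_range_self i)) (hausdorffEDist_convexHull_ne_top p x))

theorem hullDistance_le_diam {p : ι → Plane} {x : Fin n → Plane}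
    (hx : ∀ j, x j ∈ convexHull ℝ (range p)) :
    hullDistance (convexHull ℝ (range p)) x ≤ Metric.diam (convexHull ℝ (range p)) := by
  have hb := isBounded_convexHull_range p
  refine le_of_not_gt fun h => ?_
  obtain ⟨i, hi⟩ := (lt_hullDistance_iff hx Metric.diam_nonneg).1 h
  refine hi.not_ge ?_
  have h0 : x 0 ∈ convexHull ℝ (range x) := subset_convexHull ℝ _ (mem_range_self 0)
  exact (Metric.infDist_le_dist_of_mem h0).trans
    (Metric.dist_le_diam_of_mem hb (subset_convexHull ℝ _ (mem_range_self i)) (hx 0))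

end HullDistance

/-! ### Distance from a vertex to the sample hull. -/

/-- The unit vector along each edge. -/
noncomputable def edgeDir {ι : Type*} (τ : Equiv.Perm ι) (p : ι → Plane) (k : ι ⊕ ι) : Plane :=
  (edgeLength τ p k)⁻¹ • (p (edgeEnd τ k) - p (edgeBase k))

/-- The distance from a vertex to the chord cutting it off at given distances along its edges. -/
noncomputable def vertexDist {ι : Type*} (τ : Equiv.Perm ι) (p : ι → Plane) (z : ι ⊕ ι → ℝ)
    (i : ι) : ℝ :=
  cornerDist (edgeDir τ p (Sum.inl i)) (edgeDir τ p (Sum.inr i)) (z (Sum.inl i)) (z (Sum.inr i))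

/-- The points beyond the chord from `a • e₁` to `b • e₂`, in the cone spanned by `e₁`, `e₂`. -/
def beyondChord (e₁ e₂ : Plane) (a b : ℝ) : Set Plane :=
  {y | ∃ s t : ℝ, 0 ≤ s ∧ 0 ≤ t ∧ a * b ≤ s * b + t * a ∧ y = s • e₁ + t • e₂}

theorem convex_beyondChord (e₁ e₂ : Plane) (a b : ℝ) : Convex ℝ (beyondChord e₁ e₂ a b) := by
  rintro _ ⟨s, t, hs, ht, h, rfl⟩ _ ⟨s', t', hs', ht', h', rfl⟩ c d hc hd hcd
  refine ⟨c * s + d * s', c * t + d * t', by positivity, by positivity, ?_, by module⟩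
  have e : a * b = c * (a * b) + d * (a * b) := by rw [← add_mul, hcd, one_mul]
  nlinarith [mul_le_mul_of_nonneg_left h hc, mul_le_mul_of_nonneg_left h' hd]

/-- For positive legs, such a point is a chord point dilated by σ = s/a + t/b ≥ 1. A zero leg puts
the apex on the chord and makes the distance 0. -/
theorem cornerDist_le_norm_of_mem_beyondChord {e₁ e₂ : Plane} (h₁ : ‖e₁‖ = 1)
    {a b : ℝ} (ha : 0 ≤ a) (hb : 0 ≤ b) {y : Plane} (hy : y ∈ beyondChord e₁ e₂ a b) :
    cornerDist e₁ e₂ a b ≤ ‖y‖ := by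
  obtain ⟨s, t, hs, ht, h, rfl⟩ := hy
  rcases ha.eq_or_lt with rfl | ha
  · exact (cornerDist_le_left h₁ b le_rfl).trans (norm_nonneg _)
  rcases hb.eq_or_lt with rfl | hb
  · refine le_trans ?_ (norm_nonneg _)
    simpa [chordPoint] using cornerDist_le e₁ e₂ a 0 (s := 1) (by simp)
  set σ := s / a + t / b
  have hσ : 1 ≤ σ := by
    have : σ = (s * b + t * a) / (a * b) := by simp only [σ]; field_simp
    rw [this, one_le_div (by positivity)]
    exact h
  have hσ0 : 0 < σ := by linarith
  have hta : 0 ≤ t / b := by positivity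
  have hsa : 0 ≤ s / a := by positivity
  have hmem : t / b / σ ∈ Icc (0 : ℝ) 1 :=
    ⟨by positivity, by rw [div_le_one hσ0]; simp only [σ]; linarith⟩
  have e : s • e₁ + t • e₂ = σ • chordPoint e₁ e₂ a b (t / b / σ) := by
    have h1 : σ * ((1 - t / b / σ) * a) = s := by
      have : σ * ((1 - t / b / σ) * a) = (σ - t / b) * a := by field_simp
      rw [this]; simp only [σ]; field_simp; ring
    have h2 : σ * (t / b / σ * b) = t := by field_simp
    rw [chordPoint, smul_add, smul_smul, smul_smul, h1, h2]
  rw [e, norm_smul, Real.norm_of_nonneg hσ0.le]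
  exact (cornerDist_le _ _ _ _ hmem).trans (le_mul_of_one_le_left (norm_nonneg _) hσ)

namespace ConvexCycle

variable {ι : Type*} {τ : Equiv.Perm ι} {p : ι → Plane} {G : ι → Plane →ₗ[ℝ] ℝ}

theorem norm_edgeDir (H : ConvexCycle τ p G) (k : ι ⊕ ι) : ‖edgeDir τ p k‖ = 1 := by
  have := H.edgeLength_pos k
  rw [edgeDir, norm_smul, norm_inv, Real.norm_of_nonneg this.le, ← dist_eq_norm, dist_comm,
    ← edgeLength, inv_mul_cancel₀ this.ne']

theorem edgeLength_smul_edgeDir (H : ConvexCycle τ p G) (k : ι ⊕ ι) :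
    edgeLength τ p k • edgeDir τ p k = p (edgeEnd τ k) - p (edgeBase k) := by
  rw [edgeDir, smul_smul, mul_inv_cancel₀ (H.edgeLength_pos k).ne', one_smul]

theorem sub_eq_of_mem_edge (H : ConvexCycle τ p G) {k : ι ⊕ ι} {q : Plane}
    (hq : q ∈ segment ℝ (p (edgeBase k)) (p (edgeEnd τ k))) :
    q - p (edgeBase k) = edgeCoord τ p k q • edgeDir τ p k := by
  rw [edgeCoord, if_pos hq]
  obtain ⟨t, ht, rfl⟩ := mem_segment_iff_exists_lineMap.1 hq
  rw [dist_lineMap_left, Real.norm_of_nonneg ht.1, ← edgeLength, mul_smul,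
    H.edgeLength_smul_edgeDir, AffineMap.lineMap_apply, vsub_eq_sub, vadd_eq_add, add_sub_cancel_right]

theorem mem_edge_of_edgeCoord_lt {k : ι ⊕ ι} {q : Plane}
    (h : edgeCoord τ p k q < edgeLength τ p k) :
    q ∈ segment ℝ (p (edgeBase k)) (p (edgeEnd τ k)) := by
  by_contra hq
  rw [edgeCoord, if_neg hq] at h
  exact h.false

theorem vertex_mem_beyondChord (H : ConvexCycle τ p G) {i k : ι} (hki : k ≠ i) {a b : ℝ}
    (ha : 0 ≤ a) (hb : 0 ≤ b)
    (hal : a ≤ edgeLength τ p (Sum.inl i)) (hbl : b ≤ edgeLength τ p (Sum.inr i)) :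
    p k - p i ∈ beyondChord (edgeDir τ p (Sum.inl i)) (edgeDir τ p (Sum.inr i)) a b := by
  obtain ⟨s, t, hs, ht, hst, h⟩ := H.exists_coord_vertex hki
  have h1 := H.edgeLength_smul_edgeDir (Sum.inl i)
  have h2 := H.edgeLength_smul_edgeDir (Sum.inr i)
  refine ⟨s * edgeLength τ p (Sum.inl i), t * edgeLength τ p (Sum.inr i),
    mul_nonneg hs (H.edgeLength_pos _).le, mul_nonneg ht (H.edgeLength_pos _).le, ?_, ?_⟩
  · have e1 : s * (a * b) ≤ s * edgeLength τ p (Sum.inl i) * b := by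
      rw [mul_assoc]; gcongr
    have e2 : t * (a * b) ≤ t * edgeLength τ p (Sum.inr i) * a := by
      rw [mul_assoc, mul_comm a b]; gcongr
    nlinarith [mul_nonneg ha hb]
  · rw [mul_smul, mul_smul, h1, h2]
    exact h

theorem nearest_le (τ : Equiv.Perm ι) (p : ι → Plane) {n : ℕ} (x : Fin n → Plane) (k : ι ⊕ ι) (j : Fin n) :
    nearest τ p x k ≤ edgeCoord τ p k (x j) :=
  ciInf_le (finite_range _).bddBelow j

variable {n : ℕ} [NeZero n]

theorem nearest_nonneg (τ : Equiv.Perm ι) (p : ι → Plane) (x : Fin n → Plane) (k : ι ⊕ ι) :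
    0 ≤ nearest τ p x k :=
  le_ciInf fun _ => edgeCoord_nonneg _ _ _ _

/-- Points on the two edges at p i lie beyond the chord by minimality of the nearest distances; any
other edge has both endpoints beyond it, and the region is convex. -/
theorem sub_mem_beyondChord (H : ConvexCycle τ p G) {x : Fin n → Plane}
    (hlt : ∀ k, nearest τ p x k < edgeLength τ p k) {j : Fin n}
    (hx : x j ∈ ⋃ i, segment ℝ (p i) (p (τ i))) (i : ι) :
    x j - p i ∈ beyondChord (edgeDir τ p (Sum.inl i)) (edgeDir τ p (Sum.inr i))
      (nearest τ p x (Sum.inl i)) (nearest τ p x (Sum.inr i)) := by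
  obtain ⟨k, hk⟩ := mem_iUnion.1 hx
  have h0 := nearest_nonneg τ p x
  by_cases h1 : k = i
  · subst h1
    refine ⟨edgeCoord τ p (Sum.inl k) (x j), 0, edgeCoord_nonneg _ _ _ _, le_rfl, ?_,
      (H.sub_eq_of_mem_edge (k := Sum.inl k) hk).trans (by simp)⟩
    rw [zero_mul, add_zero]
    exact mul_le_mul_of_nonneg_right (nearest_le τ p x _ j) (h0 _)
  by_cases h2 : τ k = i
  · subst h2
    have hk' : x j ∈ segment ℝ (p (edgeBase (Sum.inr (τ k)))) (p (edgeEnd τ (Sum.inr (τ k)))) := by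
      rw [segment_symm]; simpa [edgeBase, edgeEnd] using hk
    refine ⟨0, edgeCoord τ p (Sum.inr (τ k)) (x j), le_rfl, edgeCoord_nonneg _ _ _ _, ?_,
      (H.sub_eq_of_mem_edge hk').trans (by simp)⟩
    rw [zero_mul, zero_add, mul_comm]
    exact mul_le_mul_of_nonneg_right (nearest_le τ p x _ j) (h0 _)
  · obtain ⟨c, d, hc, hd, hcd, hxj⟩ := hk
    have := convex_beyondChord _ _ _ _
      (H.vertex_mem_beyondChord h1 (h0 _) (h0 _) (hlt (Sum.inl i)).le (hlt (Sum.inr i)).le)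
      (H.vertex_mem_beyondChord h2 (h0 _) (h0 _) (hlt (Sum.inl i)).le (hlt (Sum.inr i)).le)
      hc hd hcd
    convert! this using 1
    rw [← hxj, smul_sub, smul_sub, ← sub_eq_zero]
    have : p i = (c + d) • p i := by rw [hcd, one_smul]
    nth_rewrite 1 [this]
    module

theorem exists_eq_add_smul_edgeDir (H : ConvexCycle τ p G) {x : Fin n → Plane} {k : ι ⊕ ι}
    (hlt : nearest τ p x k < edgeLength τ p k) :
    ∃ j, x j = p (edgeBase k) + nearest τ p x k • edgeDir τ p k := by
  obtain ⟨j, hj⟩ := exists_eq_ciInf_of_finite (f := fun j => edgeCoord τ p k (x j))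
  refine ⟨j, ?_⟩
  rw [nearest, ← hj] at hlt
  rw [nearest, ← hj, ← H.sub_eq_of_mem_edge (mem_edge_of_edgeCoord_lt hlt), add_sub_cancel]

/-- If every edge is hit, the distance from a vertex to the convex hull is the distance to the
chord between the nearest points on its two edges. -/
theorem infDist_convexHull_eq (H : ConvexCycle τ p G) {x : Fin n → Plane}
    (hx : ∀ j, x j ∈ ⋃ i, segment ℝ (p i) (p (τ i)))
    (hlt : ∀ k, nearest τ p x k < edgeLength τ p k) (i : ι) :
    Metric.infDist (p i) (convexHull ℝ (range x)) = vertexDist τ p (nearest τ p x) i := by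
  apply le_antisymm
  · obtain ⟨s, hs, e⟩ := exists_cornerDist_eq (edgeDir τ p (Sum.inl i)) (edgeDir τ p (Sum.inr i))
      (nearest τ p x (Sum.inl i)) (nearest τ p x (Sum.inr i))
    obtain ⟨j₁, h₁⟩ := H.exists_eq_add_smul_edgeDir (hlt (Sum.inl i))
    obtain ⟨j₂, h₂⟩ := H.exists_eq_add_smul_edgeDir (hlt (Sum.inr i))
    have hmem : (1 - s) • x j₁ + s • x j₂ ∈ convexHull ℝ (range x) :=
      convex_convexHull ℝ _ (subset_convexHull ℝ _ (mem_range_self j₁))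
        (subset_convexHull ℝ _ (mem_range_self j₂)) (sub_nonneg.2 hs.2) hs.1 (by ring)
    refine (Metric.infDist_le_dist_of_mem hmem).trans_eq ?_
    rw [vertexDist, e, dist_comm, dist_eq_norm, h₁, h₂, chordPoint]
    congr 1
    simp only [edgeBase, Sum.elim_inl, Sum.elim_inr, id]
    module
  · refine (Metric.le_infDist (convexHull_range_nonempty x)).2 fun y hy => ?_
    rw [dist_comm, dist_eq_norm]
    refine cornerDist_le_norm_of_mem_beyondChord (H.norm_edgeDir _)
      (nearest_nonneg _ _ _ _) (nearest_nonneg _ _ _ _) ?_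
    have hc := (convex_beyondChord (edgeDir τ p (Sum.inl i)) (edgeDir τ p (Sum.inr i))
      (nearest τ p x (Sum.inl i)) (nearest τ p x (Sum.inr i))).translate_preimage_left (-p i)
    have hsub : range x ⊆ (fun z => z + -p i) ⁻¹' beyondChord (edgeDir τ p (Sum.inl i))
        (edgeDir τ p (Sum.inr i)) (nearest τ p x (Sum.inl i)) (nearest τ p x (Sum.inr i)) := by
      rintro _ ⟨j, rfl⟩
      simpa [sub_eq_add_neg] using H.sub_mem_beyondChord hlt (hx j) i
    simpa [sub_eq_add_neg] using convexHull_min hsub hc hy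

/-- Needs no hit edges: a sample point within t on this edge would already be too close to the
vertex, and the default coordinate exceeds t. -/
theorem lt_nearest_of_lt_infDist {x : Fin n → Plane} {i : ι} {t : ℝ}
    (ht : t < edgeLength τ p (Sum.inl i))
    (h : t < Metric.infDist (p i) (convexHull ℝ (range x))) : t < nearest τ p x (Sum.inl i) := by
  rw [lt_nearest_iff]
  intro j
  rw [edgeCoord]
  split_ifs
  · rw [dist_comm]
    exact h.trans_le (Metric.infDist_le_dist_of_mem (subset_convexHull ℝ _ (mem_range_self j)))
  · exact ht

end ConvexCycle

/-! ### Limits of the rescaled tails. -/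

/-- The joint law of `n` independent points, uniformly distributed on the boundary. -/
noncomputable def sampleMeasure {ι : Type*} (p : ι → Plane) (n : ℕ) : Measure (Fin n → Plane) :=
  Measure.pi fun _ => boundaryMeasure p

/-- The rescaled distances from the vertices to the nearest points on their edges. -/
noncomputable def scaledNearest {ι : Type*} [Fintype ι] (τ : Equiv.Perm ι) (p : ι → Plane) {n : ℕ}
    (x : Fin n → Plane) (k : ι ⊕ ι) : ℝ :=
  n / cycleLength τ p * nearest τ p x k

/-- The greatest distance from a vertex to the chord cutting it off. -/
noncomputable def maxVertexDist {ι : Type*} [Fintype ι] [Nonempty ι] (τ : Equiv.Perm ι)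
    (p : ι → Plane) (z : ι ⊕ ι → ℝ) : ℝ :=
  Finset.univ.sup' Finset.univ_nonempty (vertexDist τ p z)

theorem measurable_scaledNearest {ι : Type*} [Fintype ι] (τ : Equiv.Perm ι) (p : ι → Plane)
    (n : ℕ) : Measurable fun x : Fin n → Plane => scaledNearest τ p x :=
  measurable_pi_lambda _ fun k =>
    ((measurable_pi_apply k).comp (measurable_nearest τ p n)).const_mul _

theorem lt_maxVertexDist_iff {ι : Type*} [Fintype ι] [Nonempty ι] {τ : Equiv.Perm ι}
    {p : ι → Plane} {z : ι ⊕ ι → ℝ} {r : ℝ} :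
    r < maxVertexDist τ p z ↔ ∃ i, r < vertexDist τ p z i := by
  simp [maxVertexDist, Finset.lt_sup'_iff]

theorem continuous_vertexDist {ι : Type*} (τ : Equiv.Perm ι) (p : ι → Plane) (i : ι) :
    Continuous fun z => vertexDist τ p z i := by
  have h := continuous_cornerDist (edgeDir τ p (Sum.inl i)) (edgeDir τ p (Sum.inr i))
  have h2 : Continuous fun z : ι ⊕ ι → ℝ => (z (Sum.inl i), z (Sum.inr i)) := by fun_prop
  have h3 := h.comp h2
  simpa only [vertexDist, Function.comp_def] using h3

theorem continuous_maxVertexDist {ι : Type*} [Fintype ι] [Nonempty ι] (τ : Equiv.Perm ι)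
    (p : ι → Plane) : Continuous (maxVertexDist τ p) := by
  unfold maxVertexDist
  exact Continuous.finset_sup'_apply _ fun i _ => continuous_vertexDist τ p i

theorem vertexDist_mul {ι : Type*} (τ : Equiv.Perm ι) (p : ι → Plane) {c : ℝ} (hc : 0 ≤ c)
    (z : ι ⊕ ι → ℝ) (i : ι) :
    vertexDist τ p (fun k => c * z k) i = c * vertexDist τ p z i :=
  cornerDist_mul _ _ _ _ hc

/-- The angle between the two edges at a vertex. -/
noncomputable def cycleAngle {ι : Type*} (τ : Equiv.Perm ι) (p : ι → Plane) (i : ι) : ℝ :=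
  EuclideanGeometry.angle (p (τ.symm i)) (p i) (p (τ i))

theorem frontier_mem_convexHull {ι : Type*} [Finite ι] {p : ι → Plane} {q : Plane} (h : q ∈ frontier (convexHull ℝ (range p))) :
    q ∈ convexHull ℝ (range p) :=
  ((finite_range p).isClosed_convexHull ℝ).frontier_subset h

namespace ConvexCycle

variable {ι : Type*} {τ : Equiv.Perm ι} {p : ι → Plane} {G : ι → Plane →ₗ[ℝ] ℝ}

theorem cycleAngle_mem (H : ConvexCycle τ p G) (i : ι) : cycleAngle τ p i ∈ Ioo 0 π := by
  have hli := LinearIndependent.pair_iff.1 (H.linearIndependent i)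
  rw [cycleAngle, EuclideanGeometry.angle, vsub_eq_sub, vsub_eq_sub]
  refine ⟨lt_of_le_of_ne (InnerProductGeometry.angle_nonneg _ _) fun h => ?_,
    lt_of_le_of_ne (InnerProductGeometry.angle_le_pi _ _) fun h => ?_⟩
  · obtain ⟨-, r, -, hr⟩ := InnerProductGeometry.angle_eq_zero_iff.1 h.symm
    exact one_ne_zero (hli 1 (-r) (by rw [hr]; module)).1
  · obtain ⟨-, r, -, hr⟩ := InnerProductGeometry.angle_eq_pi_iff.1 h
    exact one_ne_zero (hli 1 (-r) (by rw [hr]; module)).1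

theorem inner_edgeDir (i : ι) :
    inner ℝ (edgeDir τ p (Sum.inl i)) (edgeDir τ p (Sum.inr i)) = Real.cos (cycleAngle τ p i) := by
  rw [cycleAngle, EuclideanGeometry.angle, InnerProductGeometry.angle_comm,
    InnerProductGeometry.cos_angle, edgeDir, edgeDir, inner_smul_left, inner_smul_right,
    edgeLength, edgeLength, dist_comm, dist_comm (p (edgeBase (Sum.inr i))), dist_eq_norm,
    dist_eq_norm]
  simp only [edgeBase, edgeEnd, Sum.elim_inl, Sum.elim_inr, id, conj_trivial, vsub_eq_sub]
  rw [div_eq_mul_inv, mul_inv]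
  ring

variable [Fintype ι] [Nonempty ι]

theorem isProbabilityMeasure_sampleMeasure (H : ConvexCycle τ p G) (n : ℕ) :
    IsProbabilityMeasure (sampleMeasure p n) := by
  have := H.isProbabilityMeasure_boundaryMeasure
  unfold sampleMeasure
  infer_instance

theorem ae_sampleMeasure_mem (H : ConvexCycle τ p G) (n : ℕ) :
    ∀ᵐ x ∂(sampleMeasure p n), ∀ j, x j ∈ frontier (convexHull ℝ (range p)) := by
  have := H.isProbabilityMeasure_boundaryMeasure
  rw [ae_all_iff]
  intro j
  exact (Measure.quasiMeasurePreserving_eval (fun _ : Fin n => boundaryMeasure p) j).ae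
    (ae_mem_frontier_boundaryMeasure p)

/-- For large n the probability is exactly (1 - S/n)^n with S the sum of the positive parts;
negative levels may be replaced by 0 because nearest distances are almost surely positive. -/
theorem tendsto_scaledNearest (H : ConvexCycle τ p G) (y : ι ⊕ ι → ℝ) :
    Tendsto (fun n => (sampleMeasure p n).real {x | ∀ k, y k < scaledNearest τ p x k}) atTop
      (𝓝 (Real.exp (-∑ k, max (y k) 0))) := by
  have hL := H.cycleLength_pos
  set L := cycleLength τ p
  have hlim : ∀ c : ℝ, Tendsto (fun n : ℕ => L / n * c) atTop (𝓝 0) := fun c => by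
    simpa using (tendsto_const_div_atTop_nhds_zero_nat L).mul_const c
  have h1 : ∀ᶠ n : ℕ in atTop, ∀ k, L / n * max (y k) 0 < edgeLength τ p k :=
    eventually_all.2 fun k => (hlim _).eventually_lt_const (H.edgeLength_pos k)
  have h2 : ∀ᶠ n : ℕ in atTop, ∀ i, L / n * max (y (Sum.inl i)) 0 +
      L / n * max (y (Sum.inr (τ i))) 0 ≤ dist (p i) (p (τ i)) :=
    eventually_all.2 fun i => ((hlim _).add (hlim _)).eventually_le_const
      (by rw [add_zero]; exact H.edgeLength_pos (Sum.inl i))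
  refine (Real.tendsto_one_add_div_pow_exp (-∑ k, max (y k) 0)).congr' ?_
  filter_upwards [h1, h2, eventually_gt_atTop 0] with n h1 h2 hn
  have : NeZero n := ⟨hn.ne'⟩
  have hn' : (0 : ℝ) < n := by exact_mod_cast hn
  have h3 := H.measureReal_lt_nearest n (x := fun k => L / n * max (y k) 0)
    (fun k => by positivity) h1 h2
  rw [← Finset.mul_sum] at h3
  have e : (1 : ℝ) + -(∑ k, max (y k) 0) / n = 1 - L / n * (∑ k, max (y k) 0) / L := by
    field_simp; ring
  rw [e, ← h3]
  refine measureReal_congr ?_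
  filter_upwards [H.ae_nearest_pos n] with x hx
  refine propext (forall_congr' fun k => ?_)
  change L / n * max (y k) 0 < nearest τ p x k ↔ y k < n / L * nearest τ p x k
  have : L / n * max (y k) 0 < nearest τ p x k ↔ max (y k) 0 < n / L * nearest τ p x k := by
    rw [div_mul_eq_mul_div, div_lt_iff₀ hn', div_mul_eq_mul_div, lt_div_iff₀ hL,
      mul_comm L, mul_comm (n : ℝ)]
  rw [this, max_lt_iff, and_iff_left]
  have := hx k
  positivity

theorem ae_tendsto_lt_maxVertexDist (H : ConvexCycle τ p G) :
    ∀ᵐ r : ℝ, Tendsto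
      (fun n => (sampleMeasure p n).real {x | r < maxVertexDist τ p (scaledNearest τ p x)}) atTop
      (𝓝 ((Measure.pi fun _ : ι ⊕ ι => expMeasure 1).real {z | r < maxVertexDist τ p z})) := by
  have hprob := H.isProbabilityMeasure_sampleMeasure
  have hms := measurable_scaledNearest τ p
  let μ : ℕ → ProbabilityMeasure (ι ⊕ ι → ℝ) := fun n =>
    ⟨(sampleMeasure p n).map (scaledNearest τ p), Measure.isProbabilityMeasure_map
      (hms n).aemeasurable⟩
  let ν : ProbabilityMeasure (ι ⊕ ι → ℝ) := ⟨Measure.pi fun _ => expMeasure 1, inferInstance⟩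
  have hμ : Tendsto μ atTop (𝓝 ν) := by
    refine tendsto_of_tendsto_pi_Ioi fun y => ?_
    change Tendsto (fun n => ((sampleMeasure p n).map (scaledNearest τ p)).real _) atTop
      (𝓝 ((Measure.pi fun _ => expMeasure 1).real _))
    rw [pi_expMeasure_one_pi_Ioi]
    refine (H.tendsto_scaledNearest y).congr fun n => ?_
    rw [map_measureReal_apply (hms n) (MeasurableSet.univ_pi fun _ => measurableSet_Ioi)]
    congr 1
    ext x; simp
  filter_upwards [ae_tendsto_measureReal_lt hμ (continuous_maxVertexDist τ p)] with r hr
  refine hr.congr fun n => ?_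
  change ((sampleMeasure p n).map (scaledNearest τ p)).real _ = _
  rw [map_measureReal_apply (hms n)
    (isOpen_lt continuous_const (continuous_maxVertexDist τ p)).measurableSet]
  rfl

theorem lt_maxVertexDist_eq (H : ConvexCycle τ p G) {r : ℝ} (hr : 0 < r) :
    (Measure.pi fun _ : ι ⊕ ι => expMeasure 1).real {z | r < maxVertexDist τ p z} =
      1 - ∏ i, (1 - vertexTail (cycleAngle τ p i) r) := by
  have h := measureReal_exists_lt_eq (expMeasure 1) (fun (i : ι) (z : ℝ × ℝ) =>
    cornerDist (edgeDir τ p (Sum.inl i)) (edgeDir τ p (Sum.inr i)) z.1 z.2)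
    (fun i => (continuous_cornerDist _ _).measurable) r
  simp only [lt_maxVertexDist_iff]
  refine h.trans ?_
  congr 1
  refine Finset.prod_congr rfl fun i _ => ?_
  rw [Measure.real, expMeasure_prod_lt_cornerDist (H.norm_edgeDir _) (H.norm_edgeDir _)
    (H.cycleAngle_mem i) (inner_edgeDir i) hr, ENNReal.toReal_ofReal]
  exact mul_nonneg hr.le (integral_nonneg fun _ => (Real.exp_pos _).le)

/-- With high probability, every edge is hit. -/
theorem tendsto_exists_edgeLength_le (H : ConvexCycle τ p G) :
    Tendsto (fun n => (sampleMeasure p n).real {x | ∃ k, edgeLength τ p k ≤ nearest τ p x k}) atTop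
      (𝓝 0) := by
  have hprob := H.isProbabilityMeasure_sampleMeasure
  have hL := H.cycleLength_pos
  have hle : ∀ k, edgeLength τ p k ≤ cycleLength τ p := by
    have : ∀ i, dist (p i) (p (τ i)) ≤ cycleLength τ p := fun i =>
      Finset.single_le_sum (f := fun i => dist (p i) (p (τ i))) (fun i _ => dist_nonneg)
        (Finset.mem_univ i)
    rintro (i | i)
    · exact this i
    · simpa [edgeLength, edgeBase, edgeEnd, dist_comm] using this (τ.symm i)
  have hk : ∀ k, Tendsto (fun n : ℕ => (1 - edgeLength τ p k / 2 / cycleLength τ p) ^ n) atTop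
      (𝓝 0) := fun k => by
    have h0 := H.edgeLength_pos k
    have h1 : edgeLength τ p k / 2 / cycleLength τ p < 1 := by
      rw [div_lt_one hL]; linarith [hle k]
    exact tendsto_pow_atTop_nhds_zero_of_lt_one (by linarith)
      (by have : 0 < edgeLength τ p k / 2 / cycleLength τ p := by positivity
          linarith)
  have hsum := tendsto_finsetSum Finset.univ fun k _ => hk k
  rw [Finset.sum_const_zero] at hsum
  refine squeeze_zero' (Eventually.of_forall fun n => measureReal_nonneg) ?_ hsum
  filter_upwards [eventually_gt_atTop 0] with n hn
  have : NeZero n := ⟨hn.ne'⟩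
  rw [ofPred_exists]
  refine (measureReal_iUnion_fintype_le _).trans (Finset.sum_le_sum fun k _ => ?_)
  have h0 := H.edgeLength_pos k
  -- The exact formula needs a level strictly below the edge length; half of it suffices.
  rw [← H.measureReal_lt_nearest_single n k (t := edgeLength τ p k / 2) (by linarith) (by linarith)]
  refine measureReal_mono ?_
  intro x hx
  have hx' : edgeLength τ p k ≤ nearest τ p x k := hx
  show edgeLength τ p k / 2 < nearest τ p x k
  linarith

theorem lt_hullDistance_iff_lt_maxVertexDist (H : ConvexCycle τ p G) {n : ℕ} [NeZero n]
    {x : Fin n → Plane} (hx : ∀ j, x j ∈ frontier (convexHull ℝ (range p)))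
    (hlt : ∀ k, nearest τ p x k < edgeLength τ p k) {r : ℝ} (hr : 0 ≤ r) :
    r < n / cycleLength τ p * hullDistance (convexHull ℝ (range p)) x ↔
      r < maxVertexDist τ p (scaledNearest τ p x) := by
  have hc : 0 < n / cycleLength τ p :=
    div_pos (by exact_mod_cast NeZero.pos n) H.cycleLength_pos
  have e : scaledNearest τ p x = fun k => n / cycleLength τ p * nearest τ p x k := rfl
  rw [← div_lt_iff₀' hc, lt_hullDistance_iff (fun j => frontier_mem_convexHull (hx j))
    (by positivity), lt_maxVertexDist_iff]
  refine exists_congr fun i => ?_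
  rw [H.infDist_convexHull_eq (fun j => H.frontier_eq ▸ hx j) hlt, e, vertexDist_mul _ _ hc.le,
    div_lt_iff₀' hc]

/-- The tail events for the Hausdorff distance and for the corner maximum differ, up to a null set,
only where some edge is missed. -/
theorem ae_tendsto_lt_hullDistance (H : ConvexCycle τ p G) :
    ∀ᵐ r ∂(volume.restrict (Ioi (0 : ℝ))), Tendsto (fun n => (sampleMeasure p n).real
      {x | r < n / cycleLength τ p * hullDistance (convexHull ℝ (range p)) x}) atTop
      (𝓝 (1 - ∏ i, (1 - vertexTail (cycleAngle τ p i) r))) := by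
  have hprob := H.isProbabilityMeasure_sampleMeasure
  filter_upwards [ae_restrict_mem measurableSet_Ioi,
    ae_restrict_of_ae H.ae_tendsto_lt_maxVertexDist] with r hr h
  rw [H.lt_maxVertexDist_eq hr] at h
  refine tendsto_of_tendsto_of_dist h ?_
  refine squeeze_zero' (Eventually.of_forall fun n => dist_nonneg) ?_
    H.tendsto_exists_edgeLength_le
  filter_upwards [eventually_gt_atTop 0] with n hn
  have : NeZero n := ⟨hn.ne'⟩
  have hae : ∀ᵐ x ∂(sampleMeasure p n), (∃ k, edgeLength τ p k ≤ nearest τ p x k) ∨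
      (r < n / cycleLength τ p * hullDistance (convexHull ℝ (range p)) x ↔
        r < maxVertexDist τ p (scaledNearest τ p x)) := by
    filter_upwards [H.ae_sampleMeasure_mem n] with x hx
    by_cases hb : ∃ k, edgeLength τ p k ≤ nearest τ p x k
    · exact Or.inl hb
    · push Not at hb
      exact Or.inr (H.lt_hullDistance_iff_lt_maxVertexDist hx hb (le_of_lt hr))
  have key : ∀ A B C : Set (Fin n → Plane), (∀ᵐ x ∂(sampleMeasure p n), x ∈ A → x ∈ B ∨ x ∈ C) →
      (sampleMeasure p n).real A - (sampleMeasure p n).real B ≤ (sampleMeasure p n).real C := by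
    intro A B C h
    rw [sub_le_iff_le_add']
    refine le_trans ?_ (measureReal_union_le B C)
    exact ENNReal.toReal_mono (measure_ne_top _ _) (measure_mono_ae h)
  rw [Real.dist_eq, abs_sub_le_iff]
  constructor
  · refine key _ _ _ ?_
    filter_upwards [hae] with x hx hA
    exact hx.elim Or.inr fun h => Or.inl (h.2 hA)
  · refine key _ _ _ ?_
    filter_upwards [hae] with x hx hA
    exact hx.elim Or.inr fun h => Or.inl (h.1 hA)

/-! ### Domination and convergence of expectations. -/

/-- An exponential tail bound, uniform in the number of points. -/
theorem exists_tail_bound (H : ConvexCycle τ p G) : ∃ c > 0, ∀ n : ℕ, 0 < n → ∀ r : ℝ, 0 ≤ r →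
    (sampleMeasure p n).real
      {x | r < n / cycleLength τ p * hullDistance (convexHull ℝ (range p)) x} ≤
      Fintype.card ι * Real.exp (-c * r) := by
  have hprob := H.isProbabilityMeasure_sampleMeasure
  have hL := H.cycleLength_pos
  obtain ⟨i₀, hi₀⟩ := Finite.exists_min fun i => edgeLength τ p (Sum.inl i)
  set m := edgeLength τ p (Sum.inl i₀)
  have hm : 0 < m := H.edgeLength_pos _
  set D := max (Metric.diam (convexHull ℝ (range p))) m
  have hD : 0 < D := lt_max_of_lt_right hm
  have hc1 : m / (2 * D) ≤ 1 := by
    rw [div_le_one (by positivity)]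
    linarith [le_max_right (Metric.diam (convexHull ℝ (range p))) m]
  refine ⟨m / (2 * D), by positivity, fun n hn r hr => ?_⟩
  have : NeZero n := ⟨hn.ne'⟩
  have hn' : (0 : ℝ) < n := by exact_mod_cast hn
  set s := r / (n / cycleLength τ p)
  have hs : 0 ≤ s := by positivity
  have hset : ∀ x : Fin n → Plane,
      (r < n / cycleLength τ p * hullDistance (convexHull ℝ (range p)) x ↔
        s < hullDistance (convexHull ℝ (range p)) x) := fun x =>
    (div_lt_iff₀' (by positivity)).symm
  simp only [hset]
  -- Beyond the diameter the event is null. Otherwise s is shrunk by m/(2D), with m the shortest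
  -- edge, so that u < m and the exact power formula applies; this ratio is the decay rate.
  rcases le_or_gt D s with hDs | hDs
  · have h0 : (sampleMeasure p n).real {x | s < hullDistance (convexHull ℝ (range p)) x} = 0 := by
      rw [Measure.real, ENNReal.toReal_eq_zero_iff]
      left
      refine measure_eq_zero_iff_ae_notMem.2 ?_
      filter_upwards [H.ae_sampleMeasure_mem n] with x hx
      exact not_lt.2 ((hullDistance_le_diam fun j => frontier_mem_convexHull (hx j)).trans
        ((le_max_left _ _).trans hDs))
    rw [h0]
    positivity
  · set u := m / (2 * D) * s
    have hu0 : 0 ≤ u := by positivity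
    have hus : u ≤ s := mul_le_of_le_one_left hs hc1
    have hum : u < m := by
      have : u < m / (2 * D) * D * 2 := by
        have := mul_lt_mul_of_pos_left hDs (show 0 < m / (2 * D) by positivity)
        have : 0 < m / (2 * D) * D := by positivity
        linarith
      have e : m / (2 * D) * D * 2 = m := by field_simp
      linarith
    have hsub : (sampleMeasure p n).real {x | s < hullDistance (convexHull ℝ (range p)) x} ≤
        (sampleMeasure p n).real (⋃ i, {x | u < nearest τ p x (Sum.inl i)}) := by
      refine ENNReal.toReal_mono (measure_ne_top _ _) (measure_mono_ae ?_)
      filter_upwards [H.ae_sampleMeasure_mem n] with x hx hA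
      obtain ⟨i, hi⟩ := (lt_hullDistance_iff (fun j => frontier_mem_convexHull (hx j)) hs).1 hA
      exact mem_iUnion.2 ⟨i, lt_nearest_of_lt_infDist (hum.trans_le (hi₀ i)) (hus.trans_lt hi)⟩
    refine hsub.trans ((measureReal_iUnion_fintype_le _).trans ?_)
    have hbound : ∀ i, (sampleMeasure p n).real {x | u < nearest τ p x (Sum.inl i)} ≤
        Real.exp (-(m / (2 * D)) * r) := fun i => by
      refine (H.measureReal_lt_nearest_single n (Sum.inl i) hu0 (hum.trans_le (hi₀ i))).trans_le ?_
      have hle : u / cycleLength τ p ≤ 1 := by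
        rw [div_le_one hL]
        exact (hum.le.trans (hi₀ i)).trans (Finset.single_le_sum
          (f := fun i => dist (p i) (p (τ i))) (fun i _ => dist_nonneg) (Finset.mem_univ i))
      have h1 := pow_le_pow_left₀ (sub_nonneg.2 hle) (Real.one_sub_le_exp_neg (u / cycleLength τ p)) n
      refine h1.trans_eq ?_
      rw [← Real.exp_nat_mul]
      congr 1
      simp only [u, s]
      field_simp
    exact (Finset.sum_le_sum fun i _ => hbound i).trans_eq (by simp)

theorem integrable_hullDistance (H : ConvexCycle τ p G) {n : ℕ} (hn : 0 < n) :
    Integrable (fun x => hullDistance (convexHull ℝ (range p)) x) (sampleMeasure p n) := by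
  have hprob := H.isProbabilityMeasure_sampleMeasure
  have : NeZero n := ⟨hn.ne'⟩
  refine Integrable.of_bound (continuous_hullDistance p).aestronglyMeasurable
    (Metric.diam (convexHull ℝ (range p))) ?_
  filter_upwards [H.ae_sampleMeasure_mem n] with x hx
  rw [hullDistance, Real.norm_of_nonneg Metric.hausdorffDist_nonneg]
  exact hullDistance_le_diam fun j => frontier_mem_convexHull (hx j)

theorem antitone_tail (H : ConvexCycle τ p G) (n : ℕ) (c : ℝ) :
    Antitone fun r => (sampleMeasure p n).real
      {x | r < c * hullDistance (convexHull ℝ (range p)) x} := by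
  have hprob := H.isProbabilityMeasure_sampleMeasure
  exact fun r s hrs => measureReal_mono fun x (hx : s < _) => hrs.trans_lt hx

/-- The limit inherits measurability and the exponential bound from the tails converging to it. -/
theorem integrableOn_limit (H : ConvexCycle τ p G) :
    IntegrableOn (fun r => 1 - ∏ i, (1 - vertexTail (cycleAngle τ p i) r)) (Ioi 0) := by
  obtain ⟨c, hc, hbound⟩ := H.exists_tail_bound
  have hint : IntegrableOn (fun r => Fintype.card ι * Real.exp (-c * r)) (Ioi 0) :=
    (integrableOn_exp_mul_Ioi (by linarith) 0).const_mul _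
  refine Integrable.mono' hint ?_ ?_
  · exact aestronglyMeasurable_of_tendsto_ae atTop
      (fun n => (H.antitone_tail n _).measurable.aestronglyMeasurable) H.ae_tendsto_lt_hullDistance
  · filter_upwards [ae_restrict_mem measurableSet_Ioi, H.ae_tendsto_lt_hullDistance] with r hr h
    refine le_of_tendsto h.norm ?_
    filter_upwards [eventually_gt_atTop 0] with n hn
    rw [Real.norm_of_nonneg measureReal_nonneg]
    exact hbound n hn r (le_of_lt hr)

/-- By the layer-cake formula, L times the integral of the rescaled tail is n times the mean;
dominated convergence applies to these tails. -/
theorem tendsto_integral_hullDistance (H : ConvexCycle τ p G) :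
    Tendsto (fun n : ℕ => (n : ℝ) *
      ∫ x, hullDistance (convexHull ℝ (range p)) x ∂(sampleMeasure p n)) atTop
      (𝓝 (cycleLength τ p *
        ∫ r in Ioi (0 : ℝ), (1 - ∏ i, (1 - vertexTail (cycleAngle τ p i) r)))) := by
  have hL := H.cycleLength_pos
  obtain ⟨c, hc, hbound⟩ := H.exists_tail_bound
  have hint : IntegrableOn (fun r => Fintype.card ι * Real.exp (-c * r)) (Ioi 0) :=
    (integrableOn_exp_mul_Ioi (by linarith) 0).const_mul _
  have hdct := tendsto_integral_filter_of_dominated_convergence _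
    (Eventually.of_forall fun n => (H.antitone_tail n _).measurable.aestronglyMeasurable)
    (by
      filter_upwards [eventually_gt_atTop 0] with n hn
      filter_upwards [ae_restrict_mem measurableSet_Ioi] with r hr
      rw [Real.norm_of_nonneg measureReal_nonneg]
      exact hbound n hn r (le_of_lt hr)) hint H.ae_tendsto_lt_hullDistance
  refine (hdct.const_mul (cycleLength τ p)).congr' ?_
  filter_upwards [eventually_gt_atTop 0] with n hn
  have h := ((H.integrable_hullDistance hn).const_mul
    (n / cycleLength τ p)).integral_eq_integral_meas_lt (Eventually.of_forall fun x =>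
      mul_nonneg (by positivity) Metric.hausdorffDist_nonneg)
  rw [← h, integral_const_mul, ← mul_assoc, mul_div_cancel₀ _ hL.ne']

end ConvexCycle

theorem theorem1 {M : ℕ} (hM : 3 ≤ M) (p : Polygon Plane M) (hp : p.IsStrictlyConvex)
    {Ω : ℕ → Type*} [∀ n, MeasurableSpace (Ω n)] (P : ∀ n, Measure (Ω n))
    [∀ n, IsProbabilityMeasure (P n)] (X : ∀ n, Fin n → Ω n → Plane)
    (hunif : ∀ n, 3 ≤ n → ∀ j : Fin n,
      pdf.IsUniform (X n j) (frontier p.region) (P n) (Measure.hausdorffMeasure 1))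
    (hindep : ∀ n, 3 ≤ n → iIndepFun (X n) (P n)) :
    (∀ n, 3 ≤ n → Integrable (fun ω => hullDistance p.region (fun j => X n j ω)) (P n)) ∧
    (∀ i : Fin M, ∀ r : ℝ, 0 < r →
      IntegrableOn
        (fun y => Real.exp (-r * (y + tangentLength y (p.interiorAngle i))))
        (Ioi (tangentLower (p.interiorAngle i)))) ∧
    IntegrableOn (fun r : ℝ => 1 - ∏ i : Fin M, (1 - vertexTail (p.interiorAngle i) r)) (Ioi 0) ∧
    Tendsto
      (fun n : ℕ => (n : ℝ) * ∫ ω, hullDistance p.region (fun j => X n j ω) ∂(P n))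
      atTop
      (𝓝 (p.perimeter *
        ∫ r in Ioi (0 : ℝ), (1 - ∏ i : Fin M, (1 - vertexTail (p.interiorAngle i) r)))) := by
  obtain ⟨G, H⟩ := hp.exists_convexCycle hM
  have : NeZero M := ⟨by omega⟩
  have hL := H.cycleLength_pos
  have hX : ∀ n, 3 ≤ n → ∀ j, AEMeasurable (X n j) (P n) := fun n hn j =>
    (hunif n hn j).aemeasurable
      (by rw [Polygon.region, H.hausdorffMeasure_frontier]; simpa using hL)
      (by rw [Polygon.region, H.hausdorffMeasure_frontier]; exact ENNReal.ofReal_ne_top)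
  -- Independence and uniformity identify the law of the sample with the product measure, so
  -- everything transfers by a change of variables.
  have hmap : ∀ n, 3 ≤ n →
      (P n).map (fun ω j => X n j ω) = sampleMeasure p.vertices n := fun n hn => by
    rw [(iIndepFun_iff_map_fun_eq_pi_map (hX n hn)).1 (hindep n hn), sampleMeasure]
    congr 1
    funext j
    exact hunif n hn j
  have hXm : ∀ n, 3 ≤ n → AEMeasurable (fun ω j => X n j ω) (P n) := fun n hn =>
    aemeasurable_pi_lambda _ (hX n hn)
  refine ⟨fun n hn => ?_, fun i r hr => integrableOn_exp_tangentLength (H.cycleAngle_mem i) hr,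
    H.integrableOn_limit, H.tendsto_integral_hullDistance.congr' ?_⟩
  · have h := H.integrable_hullDistance (show 0 < n by omega)
    rw [← hmap n hn] at h
    exact h.comp_aemeasurable (hXm n hn)
  · filter_upwards [eventually_ge_atTop 3] with n hn
    have : NeZero n := ⟨by omega⟩
    rw [← hmap n hn, integral_map (hXm n hn)
      (continuous_hullDistance p.vertices).aestronglyMeasurable]
    rfl
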